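/- Let $G$ be a finite-dimensional real Lie group with Lie algebra $\mathfrak g$, and write $g\cdot\eta\in T_gG$ for the left translate of $\eta\in\mathfrak g$. For a differentiable $F:G\to V$ with values in a finite-dimensional vector space let $D_gF:\mathfrak g\to V$ be the left-trivialized derivative, $D_gF\cdot\eta=\frac{d}{ds}\big|_{s=0}F(g\exp(s\eta))$ (that is, the derivative of $F$ at $g$ in the direction $g\cdot\eta$), and let $\mathrm{ad}_\xi\eta=[\xi,\eta]$. Let $N\ge 1$, $T_0\le T_N$, and let the mode functions $f_1,\dots,f_N:G\times\mathbb R\to\mathfrak g$ be $C^1$ on $G\times[T_0,T_N]$, let $L:G\to\mathbb R$ be $C^1$ and $\varphi:G\to\mathbb R$ differentiable, and let $g_0\in G$. For $\mathcal T=(T_1,\dots,T_{N-1})$ in the set $A=\{T_0\le T_1\le\dots\le T_{N-1}\le T_N\}$ put $$f(g,\mathcal T;t)=\sum_{k=1}^N\big[1(t-T_{k-1})-1(t-T_k)\big]f_k(g;t),$$ with $1(\cdot)$ the unit step function. A trajectory for $\mathcal T$ is a continuous curve $g$ on $[T_0,T_N]$ with $g(T_0)=g_0$ and $\dot g(t)=g(t)\cdot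 f(g(t),\mathcal T;t)$ for all $t\in[T_0,T_N]\setminus\{T_0,\dots,T_N\}$. Let $\mathcal T\in A$ have a trajectory $g$. Then every $\mathcal T'\in A$ sufficiently close to $\mathcal T$ has exactly one trajectory $g_{\mathcal T'}$, so that $$J(\mathcal T')=\int_{T_0}^{T_N}L(g_{\mathcal T'}(\tau))\,d\tau+\varphi(g_{\mathcal T'}(T_N))$$ is well defined for such $\mathcal T'$. There is a continuous costate $\rho:[T_0,T_N]\to\mathfrak g^*$ with $$\dot\rho(s)^T=-\rho(s)^T\big[D_gf(g(s),\mathcal T;s)-\mathrm{ad}_{f(g(s),\mathcal T;s)}\big]-D_gL(g(s))\quad\text{for all } s\in[T_0,T_N]\setminus\{T_0,\dots,T_N\},\qquad \rho(T_N)^T=D_g\varphi(g(T_N)).$$ For every such $\rho$, the function $J$ is differentiable at $\mathcal T$ relative to $A$, with gradient $\big(\frac{dJ}{dT_1},\dots,\frac{dJ}{dT_{N-1}}\big)$ given by $$\frac{dJ}{dT_i}=\rho(T_i)^T\big[f_i(g(T_i);T_i)-f_{i+1}(g(T_i);T_i)\big],\qquad i=1,\dots,N-1;$$ in particular these are the derivatives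 of $J$ with respect to the single times $T_i$ (one-sided where the constraints of $A$ allow $T_i$ to move to one side only). -/

import Mathlib

open scoped Manifold ContDiff Topology

noncomputable section

namespace LieSwitched

section

variable {E : Type*} [NormedAddCommGroup E] [NormedSpace ℝ E]
  {H : Type*} [TopologicalSpace H] (I : ModelWithCorners ℝ E H)
  {G : Type*} [TopologicalSpace G] [ChartedSpace H G] [Group G]

/-- The left-trivialized derivative `D_g F : 𝔤 → V` of a map `F : G → V` on a Lie group: the
derivative of `F` at `g` in the direction of the left translate `g · η` of `η ∈ 𝔤`. -/
def leftDeriv {V : Type*} [NormedAddCommGroup V] [NormedSpace ℝ V]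
    (F : G → V) (g : G) (η : GroupLieAlgebra I G) : V :=
  mfderiv I 𝓘(ℝ, V) F g (mulInvariantVectorField η g)

/-- For differentiable `F`, `leftDeriv I F g η` is the derivative at `s = 0` of `s ↦ F (g * c s)`
for every curve `c` through the identity with velocity `η`, in particular for `c s = exp (s η)`. -/
theorem hasDerivAt_leftDeriv [LieGroup I ∞ G] {V : Type*} [NormedAddCommGroup V]
    [NormedSpace ℝ V] {F : G → V} {g : G} (hF : MDifferentiableAt I 𝓘(ℝ, V) F g)
    {η : GroupLieAlgebra I G} {c : ℝ → G} (hc0 : c 0 = 1)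
    (hc : HasMFDerivAt 𝓘(ℝ, ℝ) I c 0
      ((1 : ℝ →L[ℝ] ℝ).smulRight (show TangentSpace I (c 0) from η))) :
    HasDerivAt (fun s => F (g * c s)) (leftDeriv I F g η) 0 := by
  let A : E →L[ℝ] E := mfderiv I I (fun x : G => g * x) 1
  let B : E →L[ℝ] V := mfderiv I 𝓘(ℝ, V) F g
  let C : ℝ →L[ℝ] E := (1 : ℝ →L[ℝ] ℝ).smulRight (show E from η)
  have hA : HasMFDerivAt I I (fun x : G => g * x) (c 0) A := by
    rw [hc0]
    exact ((contMDiff_mul_left (I := I) (n := ∞) (a := g)).mdifferentiableAt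
      (by simp)).hasMFDerivAt
  have hB : HasMFDerivAt I 𝓘(ℝ, V) F (g * c 0) B := by
    rw [hc0, mul_one]
    exact hF.hasMFDerivAt
  have key : HasFDerivAt (fun s : ℝ => F (g * c s)) (B.comp (A.comp C)) (0 : ℝ) :=
    (hB.comp (0 : ℝ) (hA.comp (0 : ℝ) hc)).hasFDerivAt
  have hval : (B.comp (A.comp C)) 1 = leftDeriv I F g η := by
    change B (A ((1 : ℝ) • (show E from η))) = B (A η)
    rw [one_smul]
  exact hval ▸ key.hasDerivAt

variable {I} in
/-- `leftDeriv` for maps with values in the Lie algebra `𝔤`, whose underlying normed space is `E`. -/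
def leftDerivLie (F : G → GroupLieAlgebra I G) (g : G) (η : GroupLieAlgebra I G) :
    GroupLieAlgebra I G :=
  leftDeriv (V := E) I F g η

/-- The unit step function. -/
def unitStep (t : ℝ) : ℝ := if 0 ≤ t then 1 else 0

/-- All the times `T_0, T_1, …, T_{n+1}`: the initial time `t₀`, the `n` transition times `T`, and
the final time `t₁`. -/
def times {n : ℕ} (t₀ t₁ : ℝ) (T : Fin n → ℝ) : Fin (n + 2) → ℝ :=
  Fin.cons (α := fun _ => ℝ) t₀ (Fin.snoc (α := fun _ => ℝ) T t₁)

/-- The vectors of transition times with `t₀ ≤ T_1 ≤ … ≤ T_n ≤ t₁`. -/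
def admissible (n : ℕ) (t₀ t₁ : ℝ) : Set (Fin n → ℝ) :=
  {T | Monotone (times t₀ t₁ T)}

variable {I} in
/-- The switched field `f(g, T; t) = ∑ₖ [1(t - T_{k-1}) - 1(t - T_k)] f_k(g; t)` with mode functions
`f_1, …, f_{n+1}` (here indexed from `0`). -/
def switchedField {n : ℕ} (f : Fin (n + 1) → G → ℝ → GroupLieAlgebra I G) (t₀ t₁ : ℝ)
    (T : Fin n → ℝ) (g : G) (t : ℝ) : GroupLieAlgebra I G :=
  ∑ k : Fin (n + 1),
    (unitStep (t - times t₀ t₁ T k.castSucc) - unitStep (t - times t₀ t₁ T k.succ)) • f k g t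

variable {I} in
/-- `γ` is a trajectory on `[t₀, t₁]`, starting at `g₀`, of the switched system
`γ' = γ · f(γ, T; t)`: it is continuous and solves the equation away from the times
`T_0, …, T_{n+1}`, where the field jumps. -/
structure IsTrajectory {n : ℕ} (f : Fin (n + 1) → G → ℝ → GroupLieAlgebra I G) (t₀ t₁ : ℝ) (g₀ : G)
    (T : Fin n → ℝ) (γ : ℝ → G) : Prop where
  init : γ t₀ = g₀
  continuousOn : ContinuousOn γ (Set.Icc t₀ t₁)
  ode : ∀ t ∈ Set.Icc t₀ t₁, t ∉ Set.range (times t₀ t₁ T) →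
    HasMFDerivAt 𝓘(ℝ, ℝ) I γ t ((1 : ℝ →L[ℝ] ℝ).smulRight
      (mulInvariantVectorField (switchedField f t₀ t₁ T (γ t) t) (γ t)))

/-- The cost `∫ L(γ(τ)) dτ + φ(γ(t₁))` of a curve `γ`. -/
def curveCost (t₀ t₁ : ℝ) (L φ : G → ℝ) (γ : ℝ → G) : ℝ :=
  (∫ τ in t₀..t₁, L (γ τ)) + φ (γ t₁)

open Classical in
variable {I} in
/-- The objective `J(T)`: the cost of the trajectory with transition times `T` starting at `g₀`
(and `0` if there is no such trajectory on `[t₀, t₁]`). -/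
def cost {n : ℕ} (f : Fin (n + 1) → G → ℝ → GroupLieAlgebra I G) (t₀ t₁ : ℝ) (g₀ : G)
    (L φ : G → ℝ) (T : Fin n → ℝ) : ℝ :=
  if h : ∃ γ : ℝ → G, IsTrajectory f t₀ t₁ g₀ T γ then curveCost t₀ t₁ L φ h.choose else 0

variable {I} in
/-- `ρ` is a costate along `γ`: a continuous curve in the dual of `𝔤` with
`ρ' = -ρ (D_g f - ad_f) - D_g L` away from the times `T_0, …, T_{n+1}` and `ρ(t₁) = D_g φ`.
The equations between covectors are evaluated at the vectors `η ∈ 𝔤`; `ad_f η = ⁅f, η⁆`. -/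
structure IsCostate {n : ℕ} (f : Fin (n + 1) → G → ℝ → GroupLieAlgebra I G) (t₀ t₁ : ℝ)
    (L φ : G → ℝ) (T : Fin n → ℝ) (γ : ℝ → G)
    (ρ : ℝ → Module.Dual ℝ (GroupLieAlgebra I G)) : Prop where
  terminal : ∀ η : GroupLieAlgebra I G, ρ t₁ η = leftDeriv I φ (γ t₁) η
  continuousOn : ∀ η : GroupLieAlgebra I G, ContinuousOn (fun s => ρ s η) (Set.Icc t₀ t₁)
  ode : ∀ s ∈ Set.Icc t₀ t₁, s ∉ Set.range (times t₀ t₁ T) → ∀ η : GroupLieAlgebra I G,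
    HasDerivAt (fun r => ρ r η)
      (-ρ s (leftDerivLie (fun g => switchedField f t₀ t₁ T g s) (γ s) η
          - ⁅switchedField f t₀ t₁ T (γ s) s, η⁆)
        - leftDeriv I L (γ s) η) s

end

end LieSwitched

end

noncomputable section

namespace LieSwitched

open Set Filter MeasureTheory Metric Function

section Analysis

variable {E : Type*} [NormedAddCommGroup E] [NormedSpace ℝ E]
  {V : Type*} [NormedAddCommGroup V] [NormedSpace ℝ V]

/-- Grönwall's inequality in integral form. -/
theorem le_mul_exp_of_le_add_integral {u : ℝ → ℝ} {a b c K : ℝ} (hK : 0 ≤ K)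
    (hu : ContinuousOn u (Icc a b))
    (h : ∀ t ∈ Icc a b, u t ≤ c + K * ∫ s in a..t, u s) :
    ∀ t ∈ Icc a b, u t ≤ c * Real.exp (K * (t - a)) := by
  intro t ht
  have hab : a ≤ b := ht.1.trans ht.2
  set v : ℝ → ℝ := IccExtend hab ((Icc a b).domRestrict u) with hv
  have hvc : Continuous v := (continuousOn_iff_continuous_domRestrict.1 hu).Icc_extend'
  have hvu : ∀ s ∈ Icc a b, v s = u s := fun s hs => by simp [hv, IccExtend_of_mem hab _ hs]
  have hint : ∀ s ∈ Icc a b, ∫ τ in a..s, v τ = ∫ τ in a..s, u τ := fun s hs => by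
    refine intervalIntegral.integral_congr fun τ hτ => hvu τ ?_
    rw [uIcc_of_le hs.1] at hτ
    exact ⟨hτ.1, hτ.2.trans hs.2⟩
  have hd : ∀ s, HasDerivAt (fun s => c + K * ∫ τ in a..s, v τ) (K * v s) s := fun s =>
    ((hvc.integral_hasStrictDerivAt a s).hasDerivAt.const_mul K).const_add c
  have key := le_gronwallBound_of_liminf_deriv_right_le (f := fun s => c + K * ∫ τ in a..s, v τ)
    (f' := fun s => K * v s) (δ := c) (K := K) (ε := 0) (a := a) (b := b)
    (fun s _ => (hd s).continuousAt.continuousWithinAt)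
    (fun s _ r hr => (hd s).hasDerivWithinAt.liminf_right_slope_le hr) (by simp)
    (fun s hs => by
      have hs' : s ∈ Icc a b := ⟨hs.1, hs.2.le⟩
      simp only [add_zero]
      gcongr
      rw [hvu s hs', hint s hs']
      exact h s hs') t ht
  rw [gronwallBound_ε0] at key
  refine (h t ht).trans ?_
  rw [← hint t ht]
  exact key

/-- The radial retraction of a normed space onto the closed ball of radius `r`. -/
def radialRetract (r : ℝ) (x : E) : E := (r / max r ‖x‖) • x

theorem norm_radialRetract_le {r : ℝ} (hr : 0 < r) (x : E) : ‖radialRetract r x‖ ≤ r := by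
  have hM : 0 < max r ‖x‖ := lt_max_of_lt_left hr
  rw [radialRetract, norm_smul, Real.norm_of_nonneg (by positivity), div_mul_eq_mul_div,
    div_le_iff₀ hM]
  exact mul_le_mul_of_nonneg_left (le_max_right _ _) hr.le

theorem radialRetract_of_norm_le {r : ℝ} (hr : 0 < r) {x : E} (hx : ‖x‖ ≤ r) :
    radialRetract r x = x := by
  rw [radialRetract, max_eq_left hx, div_self hr.ne', one_smul]

theorem norm_radialRetract_sub_le {r : ℝ} (hr : 0 < r) (x y : E) :
    ‖radialRetract r x - radialRetract r y‖ ≤ 2 * ‖x - y‖ := by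
  have hx : 0 < max r ‖x‖ := lt_max_of_lt_left hr
  have hy : 0 < max r ‖y‖ := lt_max_of_lt_left hr
  have e : radialRetract r x - radialRetract r y
      = (r / max r ‖x‖) • (x - y) + (r / max r ‖x‖ - r / max r ‖y‖) • y := by
    simp only [radialRetract, smul_sub, sub_smul]; abel
  have hc : r / max r ‖x‖ ≤ 1 := (div_le_one hx).2 (le_max_left _ _)
  have hd : |max r ‖y‖ - max r ‖x‖| ≤ ‖x - y‖ := by
    have h1 := abs_max_sub_max_le_abs r ‖y‖ ‖x‖
    refine le_trans ?_ ((abs_norm_sub_norm_le y x).trans_eq (norm_sub_rev y x))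
    simpa [max_comm] using abs_max_sub_max_le_abs ‖y‖ ‖x‖ r
  have h2 : |r / max r ‖x‖ - r / max r ‖y‖| * ‖y‖ ≤ ‖x - y‖ := by
    have e2 : r / max r ‖x‖ - r / max r ‖y‖
        = (r / max r ‖x‖) * ((max r ‖y‖ - max r ‖x‖) / max r ‖y‖) := by
      field_simp
    rw [e2, abs_mul, abs_of_nonneg (by positivity : 0 ≤ r / max r ‖x‖), abs_div, abs_of_pos hy]
    calc r / max r ‖x‖ * (|max r ‖y‖ - max r ‖x‖| / max r ‖y‖) * ‖y‖
        ≤ 1 * (‖x - y‖ / max r ‖y‖) * max r ‖y‖ := by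
          gcongr
          exact le_max_right _ _
      _ = ‖x - y‖ := by field_simp
  rw [e]
  calc _ ≤ ‖(r / max r ‖x‖) • (x - y)‖ + ‖(r / max r ‖x‖ - r / max r ‖y‖) • y‖ := norm_add_le _ _
    _ ≤ 1 * ‖x - y‖ + ‖x - y‖ := by
        rw [norm_smul, norm_smul, Real.norm_of_nonneg (by positivity), Real.norm_eq_abs]
        gcongr
    _ = 2 * ‖x - y‖ := by ring

theorem continuous_radialRetract {r : ℝ} (hr : 0 < r) :
    Continuous (radialRetract r : E → E) := by
  have h : LipschitzWith 2 (radialRetract r : E → E) := LipschitzWith.of_dist_le_mul fun x y => by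
    simpa [dist_eq_norm] using norm_radialRetract_sub_le hr x y
  exact h.continuous

/-- Global existence for the integral equation `x(t) = x₀ + ∫ₐᵗ F(s, x(s)) ds` with a field which
is Lipschitz in the second variable and merely integrable along continuous curves. -/
theorem exists_solution_integral_equation [CompleteSpace E] {a b K : ℝ} (hab : a ≤ b) (hK : 0 ≤ K)
    {F : ℝ → E → E} (hlip : ∀ t ∈ Icc a b, ∀ x y, ‖F t x - F t y‖ ≤ K * ‖x - y‖)
    (hint : ∀ x : ℝ → E, Continuous x → IntervalIntegrable (fun s => F s (x s)) volume a b)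
    (x₀ : E) :
    ∃ x : ℝ → E, Continuous x ∧ ∀ t ∈ Icc a b, x t = x₀ + ∫ s in a..t, F s (x s) := by
  have hext : ∀ y : C(Icc a b, E), Continuous (IccExtend hab y) := fun y => y.continuous.Icc_extend'
  have hsub : ∀ {t}, t ∈ Icc a b → uIcc a t ⊆ uIcc a b := fun ht => by
    rw [uIcc_of_le ht.1, uIcc_of_le hab]; exact Icc_subset_Icc_right ht.2
  have hint' : ∀ (y : C(Icc a b, E)), ∀ t ∈ Icc a b,
      IntervalIntegrable (fun s => F s (IccExtend hab y s)) volume a t := fun y t ht =>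
    (hint _ (hext y)).mono_set (hsub ht)
  have hcont : ∀ y : C(Icc a b, E), Continuous fun t : Icc a b =>
      x₀ + ∫ s in a..(t : ℝ), F s (IccExtend hab y s) := fun y => by
    have h := intervalIntegral.continuousOn_primitive_interval'
      (hint _ (hext y)) left_mem_uIcc
    rw [uIcc_of_le hab] at h
    exact continuous_const.add (continuousOn_iff_continuous_domRestrict.1 h)
  let N : C(Icc a b, E) → C(Icc a b, E) := fun y => ⟨_, hcont y⟩
  have hN : ∀ y t, N y t = x₀ + ∫ s in a..(t : ℝ), F s (IccExtend hab y s) := fun _ _ => rfl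
  have hiter : ∀ (n : ℕ) (y z : C(Icc a b, E)) (t : Icc a b),
      ‖N^[n] y t - N^[n] z t‖ ≤ (K * (t - a)) ^ n / n.factorial * dist y z := by
    intro n y z
    induction n with
    | zero => intro t; simpa [dist_eq_norm] using ContinuousMap.dist_apply_le_dist (f := y) (g := z) t
    | succ n ih =>
      intro t
      rw [iterate_succ_apply', iterate_succ_apply', hN, hN, add_sub_add_left_eq_sub,
        ← intervalIntegral.integral_sub (hint' _ t t.2) (hint' _ t t.2)]
      have hb : ∀ s ∈ Ioc a (t : ℝ), ‖F s (IccExtend hab (N^[n] y) s)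
          - F s (IccExtend hab (N^[n] z) s)‖
          ≤ K ^ (n + 1) / n.factorial * dist y z * (s - a) ^ n := by
        intro s hs
        have hs' : s ∈ Icc a b := ⟨hs.1.le, hs.2.trans t.2.2⟩
        refine (hlip s hs' _ _).trans ?_
        rw [IccExtend_of_mem hab _ hs', IccExtend_of_mem hab _ hs']
        calc K * ‖N^[n] y ⟨s, hs'⟩ - N^[n] z ⟨s, hs'⟩‖
            ≤ K * ((K * (s - a)) ^ n / n.factorial * dist y z) := by gcongr; exact ih ⟨s, hs'⟩
          _ = _ := by rw [mul_pow]; ring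
      refine (intervalIntegral.norm_integral_le_of_norm_le t.2.1
        (ae_of_all _ hb) (Continuous.intervalIntegrable (by fun_prop) _ _)).trans_eq ?_
      rw [intervalIntegral.integral_const_mul,
        intervalIntegral.integral_comp_sub_right (fun s => s ^ n), integral_pow, sub_self,
        Nat.factorial_succ]
      push_cast
      field_simp
      simp only [mul_pow, ne_eq, Nat.add_eq_zero_iff, one_ne_zero, and_false, not_false_eq_true,
        zero_pow, sub_zero]
      ring
  obtain ⟨n, hn⟩ := ((FloorSemiring.tendsto_pow_div_factorial_atTop (K * (b - a))).eventually
    (gt_mem_nhds zero_lt_one)).exists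
  have hc0 : (0 : ℝ) ≤ (K * (b - a)) ^ n / n.factorial := by
    have := sub_nonneg.2 hab
    positivity
  have hcontr : ContractingWith (Real.toNNReal ((K * (b - a)) ^ n / n.factorial)) N^[n] := by
    refine ⟨by simpa using hn, LipschitzWith.of_dist_le_mul fun y z => ?_⟩
    rw [Real.coe_toNNReal _ hc0, ContinuousMap.dist_le (mul_nonneg hc0 dist_nonneg)]
    intro t
    rw [dist_eq_norm]
    refine (hiter n y z t).trans ?_
    have h1 := sub_nonneg.2 t.2.1
    have h2 := t.2.2
    gcongr
  have hfix := hcontr.isFixedPt_fixedPoint_iterate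
  set y := ContractingWith.fixedPoint N^[n] hcontr
  refine ⟨IccExtend hab y, hext y, fun t ht => ?_⟩
  rw [← hN y ⟨t, ht⟩, hfix.eq, IccExtend_of_mem hab _ ht]

/-- A map `Φ` on `[a, b] × E` which is jointly continuous and Lipschitz in the second variable on
the closed ball of radius `r`, and whose derivative in the second variable at `0` is `D`, uniformly
in the first variable. -/
structure UniformC1 (a b r : ℝ) (Φ : ℝ → E → V) (D : ℝ → E →L[ℝ] V) : Prop where
  continuousOn : ContinuousOn (uncurry Φ) (Icc a b ×ˢ closedBall 0 r)
  continuousOn_deriv : ContinuousOn D (Icc a b)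
  lipschitz : ∃ K, 0 ≤ K ∧ ∀ t ∈ Icc a b, ∀ x ∈ closedBall (0 : E) r, ∀ y ∈ closedBall (0 : E) r,
    ‖Φ t x - Φ t y‖ ≤ K * ‖x - y‖
  approx : ∀ ε > 0, ∃ δ > 0, ∀ t ∈ Icc a b, ∀ x, ‖x‖ ≤ δ → ‖Φ t x - Φ t 0 - D t x‖ ≤ ε * ‖x‖

theorem UniformC1.of_hasFDerivAt [ProperSpace E] {a b r R : ℝ} (hr : 0 < r) (hrR : r < R)
    {Φ : ℝ → E → V} {Φ' : ℝ → E → E →L[ℝ] V}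
    (hc : ContinuousOn (uncurry Φ) (Icc a b ×ˢ ball 0 R))
    (hc' : ContinuousOn (uncurry Φ') (Icc a b ×ˢ ball 0 R))
    (hd : ∀ t ∈ Icc a b, ∀ x ∈ ball (0 : E) R, HasFDerivAt (Φ t) (Φ' t x) x) :
    UniformC1 a b r Φ (fun t => Φ' t 0) := by
  have hsub : closedBall (0 : E) r ⊆ ball 0 R := closedBall_subset_ball hrR
  have hcomp : IsCompact (Icc a b ×ˢ closedBall (0 : E) r) :=
    isCompact_Icc.prod (isCompact_closedBall 0 r)
  have hc'' := hc'.mono (prod_mono_right (s := Icc a b) hsub)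
  refine ⟨hc.mono (prod_mono_right hsub), ?_, ?_, ?_⟩
  · refine hc''.comp (f := fun t => (t, (0 : E))) (by fun_prop) fun t ht => ⟨ht, ?_⟩
    simpa using hr.le
  · obtain ⟨K, hK⟩ := hcomp.exists_bound_of_continuousOn hc''
    refine ⟨max K 0, le_max_right _ _, fun t ht x hx y hy => ?_⟩
    exact (convex_closedBall (0 : E) r).norm_image_sub_le_of_norm_hasFDerivWithin_le
      (fun z hz => (hd t ht z (hsub hz)).hasFDerivWithinAt)
      (fun z hz => (hK (t, z) ⟨ht, hz⟩).trans (le_max_left _ _)) hy hx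
  · intro ε hε
    obtain ⟨δ, hδ, h⟩ := Metric.uniformContinuousOn_iff.1
      (hcomp.uniformContinuousOn_of_continuous hc'') ε hε
    refine ⟨min (δ / 2) r, by positivity, fun t ht x hx => ?_⟩
    have hball : ∀ z ∈ closedBall (0 : E) ‖x‖, ‖Φ' t z - Φ' t 0‖ ≤ ε := by
      intro z hz
      have hz' : ‖z‖ ≤ ‖x‖ := by simpa using hz
      have hz2 := hz'.trans hx
      have := h (t, z) ⟨ht, by simpa using hz2.trans (min_le_right _ _)⟩ (t, 0)
        ⟨ht, by simpa using hr.le⟩ (by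
          rw [dist_prod_same_left, dist_zero_right]
          exact (hz2.trans (min_le_left _ _)).trans_lt (by linarith))
      rw [dist_eq_norm] at this
      exact this.le
    have := (convex_closedBall (0 : E) ‖x‖).norm_image_sub_le_of_norm_hasFDerivWithin_le'
      (f := Φ t) (φ := Φ' t 0) (x := 0) (y := x)
      (fun z hz => (hd t ht z (hsub ?_)).hasFDerivWithinAt) hball (by simp) (by simp)
    · simpa using this
    · have hz' : ‖z‖ ≤ ‖x‖ := by simpa using hz
      simpa using (hz'.trans hx).trans (min_le_right _ _)

end Analysis

section Weights

theorem measurable_unitStep : Measurable unitStep :=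
  Measurable.ite measurableSet_Ici measurable_const measurable_const

theorem abs_unitStep_sub_le (a b : ℝ) : |unitStep a - unitStep b| ≤ 1 := by
  unfold unitStep
  split_ifs <;> norm_num

theorem unitStep_eventuallyEq {a t : ℝ} (h : t ≠ a) :
    ∀ᶠ s in 𝓝 t, unitStep (s - a) = unitStep (t - a) := by
  rcases lt_or_gt_of_ne h with h | h
  · filter_upwards [Iio_mem_nhds h] with s hs
    have : s < a := hs
    simp [unitStep, not_le.2 this, not_le.2 h]
  · filter_upwards [Ioi_mem_nhds h] with s hs
    have : a < s := hs
    simp [unitStep, this.le, h.le]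

theorem abs_unitStep_sub_eq_indicator (a b s : ℝ) :
    |unitStep (s - a) - unitStep (s - b)|
      = (Ico (min a b) (max a b)).indicator (fun _ => (1 : ℝ)) s := by
  by_cases hs : s ∈ Ico (min a b) (max a b)
  · rw [indicator_of_mem hs]
    obtain ⟨h1, h2⟩ := hs
    unfold unitStep
    rcases min_le_iff.1 h1 with h1 | h1 <;> rcases lt_max_iff.1 h2 with h2 | h2 <;>
      split_ifs <;> first | (exfalso; linarith) | norm_num
  · rw [indicator_of_notMem hs]
    unfold unitStep
    by_contra hne
    apply hs
    rw [mem_Ico, min_le_iff, lt_max_iff]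
    split_ifs at hne with h1 h2 h2
    · simp at hne
    · exact ⟨Or.inl (by linarith), Or.inr (by linarith)⟩
    · exact ⟨Or.inr (by linarith), Or.inl (by linarith)⟩
    · simp at hne

theorem integral_abs_unitStep_sub_le {c d : ℝ} (hcd : c ≤ d) (a b : ℝ) :
    ∫ s in c..d, |unitStep (s - a) - unitStep (s - b)| ≤ |a - b| := by
  simp_rw [abs_unitStep_sub_eq_indicator]
  rw [intervalIntegral.integral_of_le hcd, integral_indicator measurableSet_Ico,
    Measure.restrict_restrict measurableSet_Ico, setIntegral_const, smul_eq_mul, mul_one]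
  refine (measureReal_mono inter_subset_left (by simp)).trans_eq ?_
  rw [Real.volume_real_Ico_of_le min_le_max, max_sub_min_eq_abs']

theorem integral_unitStep_mul {a c d : ℝ} (ha : a ∈ Icc c d) (u : ℝ → ℝ) :
    ∫ s in c..d, unitStep (s - a) * u s = ∫ s in a..d, u s := by
  have hcd := ha.1.trans ha.2
  have e : ∀ s, unitStep (s - a) * u s = (Ici a).indicator u s := fun s => by
    by_cases hs : a ≤ s
    · rw [indicator_of_mem (mem_Ici.2 hs)]; simp [unitStep, hs]
    · rw [indicator_of_notMem (by simpa using hs)]; simp [unitStep, hs]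
  simp_rw [e]
  rw [intervalIntegral.integral_of_le hcd, intervalIntegral.integral_of_le ha.2,
    setIntegral_congr_set (Ioc_ae_eq_Icc (a := c) (b := d)),
    setIntegral_congr_set (Ioc_ae_eq_Icc (a := a) (b := d)),
    integral_indicator measurableSet_Ici, Measure.restrict_restrict measurableSet_Ici]
  congr 2
  ext s
  simp only [mem_inter_iff, mem_Ici, mem_Icc]
  exact ⟨fun h => ⟨h.1, h.2.2⟩, fun h => ⟨h.1, ha.1.trans h.1, h.2⟩⟩

variable {n : ℕ} {t₀ t₁ : ℝ}

theorem times_zero (T : Fin n → ℝ) : times t₀ t₁ T 0 = t₀ := by simp [times]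

theorem times_last (T : Fin n → ℝ) : times t₀ t₁ T (Fin.last (n + 1)) = t₁ := by
  rw [← Fin.succ_last]
  simp [times, -Fin.succ_last]

theorem times_castSucc_succ (T : Fin n → ℝ) (i : Fin n) :
    times t₀ t₁ T i.castSucc.succ = T i := by
  simp [times]

theorem times_succ_castSucc (T : Fin n → ℝ) (i : Fin n) :
    times t₀ t₁ T i.succ.castSucc = T i := by
  rw [← Fin.succ_castSucc, times_castSucc_succ]

theorem times_mem_Icc {T : Fin n → ℝ} (hT : T ∈ admissible n t₀ t₁) (j : Fin (n + 2)) :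
    times t₀ t₁ T j ∈ Icc t₀ t₁ := by
  have hm : Monotone (times t₀ t₁ T) := hT
  constructor
  · simpa [times_zero] using hm (Fin.zero_le j)
  · simpa [times_last] using hm (Fin.le_last j)

theorem apply_mem_Icc {T : Fin n → ℝ} (hT : T ∈ admissible n t₀ t₁) (i : Fin n) :
    T i ∈ Icc t₀ t₁ := times_castSucc_succ (t₀ := t₀) (t₁ := t₁) T i ▸ times_mem_Icc hT _

theorem le_of_admissible {T : Fin n → ℝ} (hT : T ∈ admissible n t₀ t₁) : t₀ ≤ t₁ :=
  (times_mem_Icc hT 0).1.trans (times_mem_Icc hT 0).2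

theorem abs_times_sub_le (T T' : Fin n → ℝ) (j : Fin (n + 2)) :
    |times t₀ t₁ T' j - times t₀ t₁ T j| ≤ ‖T' - T‖ := by
  induction j using Fin.cases with
  | zero => simp [times_zero]
  | succ j =>
    induction j using Fin.lastCases with
    | last => rw [Fin.succ_last, times_last, times_last]; simp
    | cast i =>
      rw [times_castSucc_succ, times_castSucc_succ]
      exact norm_le_pi_norm (T' - T) i

/-- The factor `1(t - T_{k-1}) - 1(t - T_k)` of the `k`-th mode in the switched field. -/
def modeWeight (t₀ t₁ : ℝ) (T : Fin n → ℝ) (k : Fin (n + 1)) (t : ℝ) : ℝ :=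
  unitStep (t - times t₀ t₁ T k.castSucc) - unitStep (t - times t₀ t₁ T k.succ)

theorem measurable_modeWeight (T : Fin n → ℝ) (k : Fin (n + 1)) :
    Measurable (modeWeight t₀ t₁ T k) :=
  (measurable_unitStep.comp (measurable_id.sub_const _)).sub
    (measurable_unitStep.comp (measurable_id.sub_const _))

theorem abs_modeWeight_le (T : Fin n → ℝ) (k : Fin (n + 1)) (t : ℝ) :
    |modeWeight t₀ t₁ T k t| ≤ 1 := abs_unitStep_sub_le _ _

theorem modeWeight_eventuallyEq {T : Fin n → ℝ} {t : ℝ} (ht : t ∉ range (times t₀ t₁ T))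
    (k : Fin (n + 1)) : ∀ᶠ s in 𝓝 t, modeWeight t₀ t₁ T k s = modeWeight t₀ t₁ T k t := by
  have h : ∀ j, t ≠ times t₀ t₁ T j := fun j hj => ht ⟨j, hj.symm⟩
  filter_upwards [unitStep_eventuallyEq (h k.castSucc), unitStep_eventuallyEq (h k.succ)]
    with s h1 h2
  rw [modeWeight, modeWeight, h1, h2]

theorem intervalIntegrable_modeWeight_smul {V : Type*} [NormedAddCommGroup V] [NormedSpace ℝ V]
    (T : Fin n → ℝ) (k : Fin (n + 1)) {u : ℝ → V} {a b : ℝ}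
    (hu : IntervalIntegrable u volume a b) :
    IntervalIntegrable (fun s => modeWeight t₀ t₁ T k s • u s) volume a b := by
  refine hu.mono_fun ((measurable_modeWeight T k).aestronglyMeasurable.smul
    hu.def'.aestronglyMeasurable) (ae_of_all _ fun s => ?_)
  simp only [norm_smul, Real.norm_eq_abs]
  exact mul_le_of_le_one_left (norm_nonneg _) (abs_modeWeight_le T k s)

theorem intervalIntegrable_abs_modeWeight_sub (T T' : Fin n → ℝ) (k : Fin (n + 1)) (a b : ℝ) :
    IntervalIntegrable (fun s => |modeWeight t₀ t₁ T' k s - modeWeight t₀ t₁ T k s|)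
      volume a b := by
  have h : ∀ T : Fin n → ℝ, IntervalIntegrable (modeWeight t₀ t₁ T k) volume a b := fun T => by
    simpa using intervalIntegrable_modeWeight_smul (t₀ := t₀) (t₁ := t₁) T k
      (intervalIntegrable_const (c := (1 : ℝ)) (μ := volume) (a := a) (b := b))
  exact ((h T').sub (h T)).abs

theorem integral_abs_modeWeight_sub_le (h01 : t₀ ≤ t₁) (T T' : Fin n → ℝ) (k : Fin (n + 1)) :
    ∫ s in t₀..t₁, |modeWeight t₀ t₁ T' k s - modeWeight t₀ t₁ T k s| ≤ 2 * ‖T' - T‖ := by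
  have hi : ∀ a b, IntervalIntegrable (fun s => |unitStep (s - a) - unitStep (s - b)|)
      volume t₀ t₁ := fun a b => by
    refine (intervalIntegrable_const (c := (1 : ℝ))).mono_fun
      (Measurable.aestronglyMeasurable ?_) (ae_of_all _ fun s => ?_)
    · exact ((measurable_unitStep.comp (measurable_id.sub_const a)).sub
        (measurable_unitStep.comp (measurable_id.sub_const b))).abs
    · simpa using abs_unitStep_sub_le (s - a) (s - b)
  set j := k.castSucc
  set l := k.succ
  calc _ ≤ ∫ s in t₀..t₁, (|unitStep (s - times t₀ t₁ T' j) - unitStep (s - times t₀ t₁ T j)|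
          + |unitStep (s - times t₀ t₁ T' l) - unitStep (s - times t₀ t₁ T l)|) := by
        refine intervalIntegral.integral_mono_on h01
          (intervalIntegrable_abs_modeWeight_sub T T' k _ _) ((hi _ _).add (hi _ _)) fun s _ => ?_
        rw [modeWeight, modeWeight, sub_sub_sub_comm]
        exact abs_sub _ _
    _ ≤ ‖T' - T‖ + ‖T' - T‖ := by
        rw [intervalIntegral.integral_add (hi _ _) (hi _ _)]
        exact add_le_add
          ((integral_abs_unitStep_sub_le h01 _ _).trans (abs_times_sub_le T T' _))
          ((integral_abs_unitStep_sub_le h01 _ _).trans (abs_times_sub_le T T' _))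
    _ = _ := by ring

theorem integral_modeWeight_mul {T : Fin n → ℝ} (hT : T ∈ admissible n t₀ t₁) (k : Fin (n + 1))
    {u : ℝ → ℝ} (hu : IntervalIntegrable u volume t₀ t₁) :
    ∫ s in t₀..t₁, modeWeight t₀ t₁ T k s * u s
      = (∫ s in t₀..times t₀ t₁ T k.succ, u s) - ∫ s in t₀..times t₀ t₁ T k.castSucc, u s := by
  have hi : ∀ a, IntervalIntegrable (fun s => unitStep (s - a) * u s) volume t₀ t₁ := fun a => by
    refine hu.mono_fun ((measurable_unitStep.comp
      (measurable_id.sub_const a)).aestronglyMeasurable.mul hu.def'.aestronglyMeasurable)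
      (ae_of_all _ fun s => ?_)
    simp only [norm_mul, Real.norm_eq_abs]
    refine mul_le_of_le_one_left (abs_nonneg _) ?_
    simp only [unitStep]
    split_ifs <;> simp
  have hsub : ∀ j, IntervalIntegrable u volume t₀ (times t₀ t₁ T j) := fun j => by
    refine hu.mono_set ?_
    have := times_mem_Icc hT j
    rw [uIcc_of_le this.1, uIcc_of_le (this.1.trans this.2)]
    exact Icc_subset_Icc_right this.2
  simp_rw [modeWeight, sub_mul]
  rw [intervalIntegral.integral_sub (hi _) (hi _), integral_unitStep_mul (times_mem_Icc hT _),
    integral_unitStep_mul (times_mem_Icc hT _),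
    ← intervalIntegral.integral_interval_sub_left hu (hsub k.castSucc),
    ← intervalIntegral.integral_interval_sub_left hu (hsub k.succ)]
  ring

/-- The derivative of `T ↦ ∑ₖ ∫ wₖ(T, s) uₖ(s) ds = ∑ₖ ∫ₖ uₖ`, with `∫ₖ` the integral from `T_{k-1}`
to `T_k`. -/
theorem hasFDerivWithinAt_sum_integral_modeWeight {T : Fin n → ℝ} (hT : T ∈ admissible n t₀ t₁)
    {u : Fin (n + 1) → ℝ → ℝ} (hu : ∀ k, ContinuousOn (u k) (Icc t₀ t₁)) :
    HasFDerivWithinAt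
      (fun T' : Fin n → ℝ => ∑ k, ∫ s in t₀..t₁, modeWeight t₀ t₁ T' k s * u k s)
      (∑ i : Fin n, (u i.castSucc (T i) - u i.succ (T i)) •
          (ContinuousLinearMap.proj i : (Fin n → ℝ) →L[ℝ] ℝ)) (admissible n t₀ t₁) T := by
  have h01 := le_of_admissible hT
  let v : Fin (n + 1) → ℝ → ℝ := fun k => IccExtend h01 ((Icc t₀ t₁).domRestrict (u k))
  have hv : ∀ k, Continuous (v k) := fun k =>
    (continuousOn_iff_continuous_domRestrict.1 (hu k)).Icc_extend'
  have hvu : ∀ k, ∀ s ∈ Icc t₀ t₁, v k s = u k s := fun k s hs => by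
    simp only [v, IccExtend_of_mem h01 _ hs, domRestrict_apply]
  let W : Fin (n + 1) → ℝ → ℝ := fun k t => ∫ s in t₀..t, v k s
  have hW : ∀ k t, HasDerivAt (W k) (v k t) t := fun k t =>
    ((hv k).integral_hasStrictDerivAt t₀ t).hasDerivAt
  have main : ∀ T' ∈ admissible n t₀ t₁,
      ∑ k, ∫ s in t₀..t₁, modeWeight t₀ t₁ T' k s * u k s
        = (∑ i : Fin n, (W i.castSucc (T' i) - W i.succ (T' i)))
          + (W (Fin.last n) t₁ - W 0 t₀) := by
    intro T' hT'
    have e : ∀ k, ∫ s in t₀..t₁, modeWeight t₀ t₁ T' k s * u k s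
        = W k (times t₀ t₁ T' k.succ) - W k (times t₀ t₁ T' k.castSucc) := fun k => by
      rw [← integral_modeWeight_mul hT' k ((hv k).intervalIntegrable _ _)]
      refine intervalIntegral.integral_congr fun s hs => ?_
      rw [uIcc_of_le h01] at hs
      simp only [hvu k s hs]
    simp_rw [e]
    rw [Finset.sum_sub_distrib, Fin.sum_univ_castSucc, Fin.sum_univ_succ (n := n)
      (f := fun k => W k (times t₀ t₁ T' k.castSucc)), Finset.sum_sub_distrib]
    simp_rw [times_castSucc_succ, times_succ_castSucc]
    rw [Fin.succ_last, times_last, Fin.castSucc_zero, times_zero]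
    ring
  have hd : HasFDerivAt (fun T' : Fin n → ℝ =>
      (∑ i : Fin n, (W i.castSucc (T' i) - W i.succ (T' i))) + (W (Fin.last n) t₁ - W 0 t₀))
      (∑ i : Fin n, (u i.castSucc (T i) - u i.succ (T i)) •
          (ContinuousLinearMap.proj i : (Fin n → ℝ) →L[ℝ] ℝ)) T := by
    refine HasFDerivAt.add_const _ (HasFDerivAt.fun_sum fun i _ => ?_)
    rw [← hvu _ _ (apply_mem_Icc hT i), ← hvu _ _ (apply_mem_Icc hT i)]
    have hp : HasFDerivAt (fun T' : Fin n → ℝ => T' i)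
      (ContinuousLinearMap.proj i : (Fin n → ℝ) →L[ℝ] ℝ) T := hasFDerivAt_apply i T
    exact ((hW i.castSucc (T i)).sub (hW i.succ (T i))).comp_hasFDerivAt T hp
  exact hd.hasFDerivWithinAt.congr main (main T hT)

end Weights

section Tube

variable {E : Type*} [NormedAddCommGroup E] [NormedSpace ℝ E]
  {V : Type*} [NormedAddCommGroup V] [NormedSpace ℝ V]

theorem hasDerivAt_of_eq_add_integral [CompleteSpace E] {a b : ℝ} {x v : ℝ → E} {x₀ : E}
    (hv : IntervalIntegrable v volume a b)
    (hx : ∀ t ∈ Icc a b, x t = x₀ + ∫ s in a..t, v s) {t : ℝ} (ht : t ∈ Ioo a b)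
    (hvt : ContinuousAt v t) : HasDerivAt x (v t) t := by
  have hab := ht.1.trans ht.2
  have hmem : Ioo a b ∈ 𝓝 t := Ioo_mem_nhds ht.1 ht.2
  have hsm : StronglyMeasurableAtFilter v (𝓝 t) :=
    ⟨Ioc a b, mem_of_superset hmem Ioo_subset_Ioc_self, hv.aestronglyMeasurable⟩
  have hi : IntervalIntegrable v volume a t := hv.mono_set (by
    rw [uIcc_of_le ht.1.le, uIcc_of_le hab.le]; exact Icc_subset_Icc_right ht.2.le)
  refine ((intervalIntegral.integral_hasDerivAt_right hi hsm hvt).const_add x₀).congr_of_eventuallyEq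
    ?_
  filter_upwards [hmem] with s hs
  exact hx s ⟨hs.1.le, hs.2.le⟩

theorem UniformC1.continuousOn_comp {a b r c : ℝ} (hc : c ≤ b) {Φ : ℝ → E → V}
    {D : ℝ → E →L[ℝ] V} (h : UniformC1 a b r Φ D) {x : ℝ → E} (hx : ContinuousOn x (Icc a c))
    (hxr : ∀ t ∈ Icc a c, ‖x t‖ ≤ r) : ContinuousOn (fun t => Φ t (x t)) (Icc a c) :=
  h.continuousOn.comp (f := fun t => (t, x t)) (continuousOn_id.prodMk hx)
    fun t ht => ⟨⟨ht.1, ht.2.trans hc⟩, by simpa using hxr t ht⟩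

theorem UniformC1.eventually_approx {a b r : ℝ} {Φ : ℝ → E → V} {D : ℝ → E →L[ℝ] V}
    (h : UniformC1 a b r Φ D) {ε : ℝ} (hε : 0 < ε) :
    ∀ᶠ ρ in 𝓝[>] (0 : ℝ), ∀ t ∈ Icc a b, ∀ x, ‖x‖ ≤ ρ → ‖Φ t x - Φ t 0 - D t x‖ ≤ ε * ‖x‖ := by
  obtain ⟨δ, hδ, H⟩ := h.approx ε hε
  filter_upwards [Ioc_mem_nhdsGT hδ] with ρ hρ t ht x hx
  exact H t ht x (hx.trans hρ.2)

variable {n : ℕ} {t₀ t₁ r : ℝ}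

/-- The field `∑ₖ (wₖ(T', t) Pₖ(t, x) - wₖ(T, t) Qₖ(t, x))`, with `wₖ` the weights of the modes. -/
def tubeField (t₀ t₁ : ℝ) (P Q : Fin (n + 1) → ℝ → E → E) (T T' : Fin n → ℝ) (t : ℝ) (x : E) : E :=
  ∑ k, (modeWeight t₀ t₁ T' k t • P k t x - modeWeight t₀ t₁ T k t • Q k t x)

/-- The linearization at `x = 0` of the unperturbed field `tubeField t₀ t₁ P Q T T`. -/
def tubeLinearization (t₀ t₁ : ℝ) (DP DQ : Fin (n + 1) → ℝ → E →L[ℝ] E) (T : Fin n → ℝ) (t : ℝ) :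
    E →L[ℝ] E :=
  ∑ k, modeWeight t₀ t₁ T k t • (DP k t - DQ k t)

/-- `P` and `Q` are uniformly `C¹` families near `0`, which agree at `0`. -/
structure IsTubeSystem (t₀ t₁ r : ℝ) (P Q : Fin (n + 1) → ℝ → E → E)
    (DP DQ : Fin (n + 1) → ℝ → E →L[ℝ] E) : Prop where
  pos : 0 < r
  left : ∀ k, UniformC1 t₀ t₁ r (P k) (DP k)
  right : ∀ k, UniformC1 t₀ t₁ r (Q k) (DQ k)
  agree : ∀ k, ∀ t ∈ Icc t₀ t₁, P k t 0 = Q k t 0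

/-- `x` is a solution in the closed ball of radius `r`, on the interval `[t₀, b]`, of the integral
equation of the field `tubeField`. -/
structure IsTubeSolution (t₀ t₁ r : ℝ) (P Q : Fin (n + 1) → ℝ → E → E) (T T' : Fin n → ℝ) (b : ℝ)
    (x : ℝ → E) : Prop where
  continuousOn : ContinuousOn x (Icc t₀ b)
  norm_le : ∀ t ∈ Icc t₀ b, ‖x t‖ ≤ r
  eq_integral : ∀ t ∈ Icc t₀ b, x t = ∫ s in t₀..t, tubeField t₀ t₁ P Q T T' s (x s)

namespace IsTubeSystem

variable {P Q : Fin (n + 1) → ℝ → E → E} {DP DQ : Fin (n + 1) → ℝ → E →L[ℝ] E}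
  {T T' : Fin n → ℝ}

theorem intervalIntegrable (h : IsTubeSystem t₀ t₁ r P Q DP DQ) (T T' : Fin n → ℝ) {b : ℝ}
    (hb : b ∈ Icc t₀ t₁) {x : ℝ → E}
    (hx : ContinuousOn x (Icc t₀ b)) (hxr : ∀ t ∈ Icc t₀ b, ‖x t‖ ≤ r) :
    IntervalIntegrable (fun s => tubeField t₀ t₁ P Q T T' s (x s)) volume t₀ b := by
  have e : (fun s => tubeField t₀ t₁ P Q T T' s (x s))
      = ∑ k, fun s => (modeWeight t₀ t₁ T' k s • P k s (x s)
        - modeWeight t₀ t₁ T k s • Q k s (x s)) := by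
    ext s; simp [tubeField]
  rw [e]
  refine IntervalIntegrable.sum _ fun k _ => ?_
  have hu : uIcc t₀ b = Icc t₀ b := uIcc_of_le hb.1
  refine (intervalIntegrable_modeWeight_smul T' k (ContinuousOn.intervalIntegrable ?_)).sub
    (intervalIntegrable_modeWeight_smul T k (ContinuousOn.intervalIntegrable ?_))
  · rw [hu]; exact (h.left k).continuousOn_comp hb.2 hx hxr
  · rw [hu]; exact (h.right k).continuousOn_comp hb.2 hx hxr

theorem continuousAt (h : IsTubeSystem t₀ t₁ r P Q DP DQ) {x : ℝ → E}
    (hx : ContinuousOn x (Icc t₀ t₁)) (hxr : ∀ t ∈ Icc t₀ t₁, ‖x t‖ ≤ r) {t : ℝ}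
    (ht : t ∈ Ioo t₀ t₁) (hT : t ∉ range (times t₀ t₁ T)) (hT' : t ∉ range (times t₀ t₁ T')) :
    ContinuousAt (fun s => tubeField t₀ t₁ P Q T T' s (x s)) t := by
  have hmem : Icc t₀ t₁ ∈ 𝓝 t := Icc_mem_nhds ht.1 ht.2
  have hw : ∀ {T : Fin n → ℝ}, t ∉ range (times t₀ t₁ T) → ∀ k,
      ContinuousAt (modeWeight t₀ t₁ T k) t := fun hT k =>
    (continuousAt_const (y := modeWeight t₀ t₁ _ k t)).congr
      ((modeWeight_eventuallyEq hT k).mono fun _ hs => hs.symm)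
  refine tendsto_finsetSum _ fun k _ => ?_
  exact ((hw hT' k).smul (((h.left k).continuousOn_comp le_rfl hx hxr).continuousAt hmem)).sub
    ((hw hT k).smul (((h.right k).continuousOn_comp le_rfl hx hxr).continuousAt hmem))

theorem hasDerivAt [CompleteSpace E] (h : IsTubeSystem t₀ t₁ r P Q DP DQ) {x : ℝ → E}
    (hx : IsTubeSolution t₀ t₁ r P Q T T' t₁ x) {t : ℝ}
    (ht : t ∈ Ioo t₀ t₁) (hT : t ∉ range (times t₀ t₁ T)) (hT' : t ∉ range (times t₀ t₁ T')) :
    HasDerivAt x (tubeField t₀ t₁ P Q T T' t (x t)) t :=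
  hasDerivAt_of_eq_add_integral (x₀ := 0)
    (h.intervalIntegrable T T' (right_mem_Icc.2 (ht.1.trans ht.2).le) hx.continuousOn hx.norm_le)
    (fun t ht => by rw [zero_add, hx.eq_integral t ht]) ht
    (h.continuousAt hx.continuousOn hx.norm_le ht hT hT')

theorem exists_lipschitz (h : IsTubeSystem t₀ t₁ r P Q DP DQ) :
    ∃ K, 0 ≤ K ∧ (∀ k, ∀ t ∈ Icc t₀ t₁, ∀ x ∈ closedBall (0 : E) r, ∀ y ∈ closedBall (0 : E) r,
      ‖P k t x - P k t y‖ ≤ K * ‖x - y‖) ∧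
    ∀ T T' : Fin n → ℝ, ∀ t ∈ Icc t₀ t₁,
      ∀ x ∈ closedBall (0 : E) r, ∀ y ∈ closedBall (0 : E) r,
      ‖tubeField t₀ t₁ P Q T T' t x - tubeField t₀ t₁ P Q T T' t y‖ ≤ K * ‖x - y‖ := by
  choose KP hKP hP using fun k => (h.left k).lipschitz
  choose KQ hKQ hQ using fun k => (h.right k).lipschitz
  have hK0 : ∀ k, 0 ≤ KP k + KQ k := fun k => add_nonneg (hKP k) (hKQ k)
  refine ⟨∑ k, (KP k + KQ k), Finset.sum_nonneg fun k _ => hK0 k, fun k t ht x hx y hy => ?_,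
    fun T T' t ht x hx y hy => ?_⟩
  · refine (hP k t ht x hx y hy).trans (mul_le_mul_of_nonneg_right ?_ (norm_nonneg _))
    exact (le_add_of_nonneg_right (hKQ k)).trans
      (Finset.single_le_sum (f := fun k => KP k + KQ k) (fun k _ => hK0 k) (Finset.mem_univ k))
  · rw [tubeField, tubeField, ← Finset.sum_sub_distrib, Finset.sum_mul]
    refine norm_sum_le_of_le _ fun k _ => ?_
    rw [sub_sub_sub_comm, ← smul_sub, ← smul_sub, add_mul]
    refine (norm_sub_le _ _).trans (add_le_add ?_ ?_)
    · rw [norm_smul]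
      exact (mul_le_of_le_one_left (norm_nonneg _) (abs_modeWeight_le T' k t)).trans
        (hP k t ht x hx y hy)
    · rw [norm_smul]
      exact (mul_le_of_le_one_left (norm_nonneg _) (abs_modeWeight_le T k t)).trans
        (hQ k t ht x hx y hy)

theorem zero_mem (h : IsTubeSystem t₀ t₁ r P Q DP DQ) : (0 : E) ∈ closedBall (0 : E) r := by
  simpa using h.pos.le

theorem tubeField_zero (h : IsTubeSystem t₀ t₁ r P Q DP DQ) {t : ℝ} (ht : t ∈ Icc t₀ t₁) :
    tubeField t₀ t₁ P Q T T' t 0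
      = ∑ k, (modeWeight t₀ t₁ T' k t - modeWeight t₀ t₁ T k t) • P k t 0 := by
  simp only [tubeField, ← h.agree _ t ht, sub_smul]

theorem continuousOn_left_zero (h : IsTubeSystem t₀ t₁ r P Q DP DQ) (k : Fin (n + 1)) :
    ContinuousOn (fun t => P k t 0) (Icc t₀ t₁) :=
  (h.left k).continuousOn_comp (x := fun _ => 0) le_rfl continuousOn_const
    fun _ _ => by simpa using h.pos.le

theorem intervalIntegrable_zero (h : IsTubeSystem t₀ t₁ r P Q DP DQ) (h01 : t₀ ≤ t₁)
    (T T' : Fin n → ℝ) :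
    IntervalIntegrable (fun s => tubeField t₀ t₁ P Q T T' s 0) volume t₀ t₁ :=
  h.intervalIntegrable T T' (right_mem_Icc.2 h01) (x := fun _ => 0) continuousOn_const
    fun _ _ => by simpa using h.pos.le

theorem exists_integral_norm_zero_le (h : IsTubeSystem t₀ t₁ r P Q DP DQ) (h01 : t₀ ≤ t₁) :
    ∃ M, 0 ≤ M ∧ ∀ T T' : Fin n → ℝ,
      ∫ s in t₀..t₁, ‖tubeField t₀ t₁ P Q T T' s 0‖ ≤ M * ‖T' - T‖ := by
  choose M hM using fun k => isCompact_Icc.exists_bound_of_continuousOn (h.continuousOn_left_zero k)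
  refine ⟨∑ k, |M k| * 2, Finset.sum_nonneg fun k _ => by positivity, fun T T' => ?_⟩
  have hi : ∀ k, IntervalIntegrable
      (fun s => |M k| * |modeWeight t₀ t₁ T' k s - modeWeight t₀ t₁ T k s|) volume t₀ t₁ :=
    fun k => (intervalIntegrable_abs_modeWeight_sub T T' k t₀ t₁).const_mul _
  calc _ ≤ ∫ s in t₀..t₁, ∑ k, |M k| * |modeWeight t₀ t₁ T' k s - modeWeight t₀ t₁ T k s| := by
        refine intervalIntegral.integral_mono_on h01 (h.intervalIntegrable_zero h01 T T').norm
          (by simpa only [Finset.sum_fn] using IntervalIntegrable.sum _ fun k _ => hi k)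
          fun s hs => ?_
        rw [h.tubeField_zero hs]
        refine norm_sum_le_of_le _ fun k _ => ?_
        rw [norm_smul, mul_comm, Real.norm_eq_abs]
        exact mul_le_mul_of_nonneg_right ((hM k s hs).trans (le_abs_self _)) (abs_nonneg _)
    _ = ∑ k, |M k| * ∫ s in t₀..t₁, |modeWeight t₀ t₁ T' k s - modeWeight t₀ t₁ T k s| := by
        rw [intervalIntegral.integral_finsetSum fun k _ => hi k]
        simp_rw [intervalIntegral.integral_const_mul]
    _ ≤ ∑ k, |M k| * (2 * ‖T' - T‖) := by
        gcongr with k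
        exact integral_abs_modeWeight_sub_le h01 T T' k
    _ = _ := by rw [Finset.sum_mul]; simp_rw [mul_assoc]

/-- An a priori bound: solutions stay close to `0` as long as they do not leave the tube; the same
for the field composed with a retraction `π` of the tube. -/
theorem exists_norm_le_of_eq_integral (h : IsTubeSystem t₀ t₁ r P Q DP DQ) (h01 : t₀ ≤ t₁) :
    ∃ C, 0 ≤ C ∧ ∀ T T' : Fin n → ℝ, ∀ b ∈ Icc t₀ t₁, ∀ x y : ℝ → E, ContinuousOn x (Icc t₀ b) →
      ContinuousOn y (Icc t₀ b) → (∀ t ∈ Icc t₀ b, ‖y t‖ ≤ r) → (∀ t ∈ Icc t₀ b, ‖y t‖ ≤ 2 * ‖x t‖) →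
      (∀ t ∈ Icc t₀ b, x t = ∫ s in t₀..t, tubeField t₀ t₁ P Q T T' s (y s)) →
      ∀ t ∈ Icc t₀ b, ‖x t‖ ≤ C * ‖T' - T‖ := by
  obtain ⟨K, hK, -, hlip⟩ := h.exists_lipschitz
  obtain ⟨M, hM, hMT⟩ := h.exists_integral_norm_zero_le h01
  refine ⟨M * Real.exp (2 * K * (t₁ - t₀)), by positivity,
    fun T T' b hb x y hx hy hyr hyx heq t ht => ?_⟩
  have hxi : ∀ c ∈ Icc t₀ b, IntervalIntegrable (fun s => ‖x s‖) volume t₀ c := fun c hc => by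
    refine ContinuousOn.intervalIntegrable ?_
    rw [uIcc_of_le hc.1]
    exact hx.norm.mono (Icc_subset_Icc_right hc.2)
  have hg := le_mul_exp_of_le_add_integral (u := fun s => ‖x s‖) (a := t₀) (b := b)
    (c := M * ‖T' - T‖) (K := 2 * K) (by positivity) hx.norm (fun c hc => ?_) t ht
  · refine hg.trans ?_
    rw [mul_right_comm]
    have := ht.2.trans hb.2
    gcongr
  · have hc1 : c ≤ t₁ := hc.2.trans hb.2
    have h0 := h.intervalIntegrable_zero h01 T T'
    have h0c : IntervalIntegrable (fun s => ‖tubeField t₀ t₁ P Q T T' s 0‖) volume t₀ c :=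
      h0.norm.mono_set (by
        rw [uIcc_of_le hc.1, uIcc_of_le h01]; exact Icc_subset_Icc_right hc1)
    rw [heq c hc]
    calc _ ≤ ∫ s in t₀..c, (‖tubeField t₀ t₁ P Q T T' s 0‖ + 2 * K * ‖x s‖) := by
          refine intervalIntegral.norm_integral_le_of_norm_le hc.1 (ae_of_all _ fun s hs => ?_)
            (h0c.add ((hxi c hc).const_mul _))
          have hsb : s ∈ Icc t₀ b := ⟨hs.1.le, hs.2.trans hc.2⟩
          have hs1 : s ∈ Icc t₀ t₁ := ⟨hs.1.le, hs.2.trans hc1⟩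
          have := hlip T T' s hs1 (y s) (by simpa using hyr s hsb) 0 h.zero_mem
          rw [sub_zero] at this
          calc _ ≤ ‖tubeField t₀ t₁ P Q T T' s 0‖
                + ‖tubeField t₀ t₁ P Q T T' s (y s) - tubeField t₀ t₁ P Q T T' s 0‖ :=
                norm_le_norm_add_norm_sub' _ _
            _ ≤ ‖tubeField t₀ t₁ P Q T T' s 0‖ + K * (2 * ‖x s‖) := by
                gcongr
                exact this.trans (mul_le_mul_of_nonneg_left (hyx s hsb) hK)
            _ = _ := by ring
      _ ≤ M * ‖T' - T‖ + 2 * K * ∫ s in t₀..c, ‖x s‖ := by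
          rw [intervalIntegral.integral_add h0c ((hxi c hc).const_mul _),
            intervalIntegral.integral_const_mul]
          gcongr
          refine le_trans ?_ (hMT T T')
          exact intervalIntegral.integral_mono_interval le_rfl hc.1 hc1
            (ae_of_all _ fun s => norm_nonneg _) h0.norm

theorem exists_norm_le (h : IsTubeSystem t₀ t₁ r P Q DP DQ) (h01 : t₀ ≤ t₁) :
    ∃ C, 0 ≤ C ∧ ∀ T T' : Fin n → ℝ, ∀ b ∈ Icc t₀ t₁, ∀ x : ℝ → E,
      IsTubeSolution t₀ t₁ r P Q T T' b x → ∀ t ∈ Icc t₀ b, ‖x t‖ ≤ C * ‖T' - T‖ := by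
  obtain ⟨C, hC, H⟩ := h.exists_norm_le_of_eq_integral h01
  exact ⟨C, hC, fun T T' b hb x hx => H T T' b hb x x hx.continuousOn hx.continuousOn hx.norm_le
    (fun t _ => by linarith [norm_nonneg (x t)]) hx.eq_integral⟩

theorem eqOn_of_isTubeSolution (h : IsTubeSystem t₀ t₁ r P Q DP DQ)
    {x y : ℝ → E} (hx : IsTubeSolution t₀ t₁ r P Q T T' t₁ x)
    (hy : IsTubeSolution t₀ t₁ r P Q T T' t₁ y) : EqOn x y (Icc t₀ t₁) := by
  obtain ⟨K, hK, -, hlip⟩ := h.exists_lipschitz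
  intro t ht
  have hc := (hx.continuousOn.sub hy.continuousOn).norm
  have := le_mul_exp_of_le_add_integral (u := fun s => ‖x s - y s‖) (a := t₀) (b := t₁)
    (c := 0) hK hc (fun c hc' => ?_) t ht
  · rw [zero_mul] at this
    exact sub_eq_zero.1 (norm_le_zero_iff.1 this)
  · have hxi := h.intervalIntegrable T T' hc' (hx.continuousOn.mono (Icc_subset_Icc_right hc'.2))
      fun s hs => hx.norm_le s ⟨hs.1, hs.2.trans hc'.2⟩
    have hyi := h.intervalIntegrable T T' hc' (hy.continuousOn.mono (Icc_subset_Icc_right hc'.2))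
      fun s hs => hy.norm_le s ⟨hs.1, hs.2.trans hc'.2⟩
    rw [hx.eq_integral c hc', hy.eq_integral c hc', ← intervalIntegral.integral_sub hxi hyi,
      zero_add, ← intervalIntegral.integral_const_mul]
    refine intervalIntegral.norm_integral_le_of_norm_le hc'.1 (ae_of_all _ fun s hs => ?_)
      (ContinuousOn.intervalIntegrable ?_)
    · have hs1 : s ∈ Icc t₀ t₁ := ⟨hs.1.le, hs.2.trans hc'.2⟩
      exact hlip T T' s hs1 _ (by simpa using hx.norm_le s hs1) _ (by simpa using hy.norm_le s hs1)
    · rw [uIcc_of_le hc'.1]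
      exact (continuousOn_const.mul hc).mono (Icc_subset_Icc_right hc'.2)

theorem exists_isTubeSolution [CompleteSpace E] (h : IsTubeSystem t₀ t₁ r P Q DP DQ)
    (h01 : t₀ ≤ t₁) : ∃ η > 0, ∀ T T' : Fin n → ℝ, ‖T' - T‖ ≤ η →
      ∃ x, IsTubeSolution t₀ t₁ r P Q T T' t₁ x := by
  obtain ⟨K, hK, -, hlip⟩ := h.exists_lipschitz
  obtain ⟨C, hC, hbd⟩ := h.exists_norm_le_of_eq_integral h01
  obtain ⟨η, hη, hCη⟩ := exists_pos_mul_lt h.pos C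
  refine ⟨η, hη, fun T T' hT => ?_⟩
  have hπ := continuous_radialRetract (E := E) h.pos
  obtain ⟨x, hx, hxeq⟩ := exists_solution_integral_equation (K := K * 2) h01 (by positivity)
    (F := fun t x => tubeField t₀ t₁ P Q T T' t (radialRetract r x))
    (fun t ht x y => (hlip T T' t ht _ (by simpa using norm_radialRetract_le h.pos x) _
      (by simpa using norm_radialRetract_le h.pos y)).trans (by
        rw [mul_assoc]
        exact mul_le_mul_of_nonneg_left (norm_radialRetract_sub_le h.pos x y) hK))
    (fun x hx => h.intervalIntegrable T T' (right_mem_Icc.2 h01) (hπ.comp hx).continuousOn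
      fun t _ => norm_radialRetract_le h.pos _) 0
  simp only [zero_add] at hxeq
  have hsmall : ∀ t ∈ Icc t₀ t₁, ‖x t‖ ≤ r := fun t ht => by
    refine (hbd T T' t₁ (right_mem_Icc.2 h01) x (fun s => radialRetract r (x s)) hx.continuousOn
      (hπ.comp hx).continuousOn (fun t _ => norm_radialRetract_le h.pos _) (fun t _ => ?_)
      hxeq t ht).trans ?_
    · simpa [radialRetract_of_norm_le h.pos (x := (0 : E)) (by simpa using h.pos.le)]
        using norm_radialRetract_sub_le h.pos (x t) 0
    · exact (mul_le_mul_of_nonneg_left hT hC).trans hCη.le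
  refine ⟨x, hx.continuousOn, hsmall, fun t ht => (hxeq t ht).trans ?_⟩
  refine intervalIntegral.integral_congr fun s hs => ?_
  rw [uIcc_of_le ht.1] at hs
  simp only [radialRetract_of_norm_le h.pos (hsmall s ⟨hs.1, hs.2.trans ht.2⟩)]

end IsTubeSystem

end Tube

section Costate

variable {E : Type*} [NormedAddCommGroup E] [NormedSpace ℝ E]
  {n : ℕ} {t₀ t₁ r : ℝ}
  {P Q : Fin (n + 1) → ℝ → E → E} {DP DQ : Fin (n + 1) → ℝ → E →L[ℝ] E}
  {ℓ : ℝ → E → ℝ} {Dℓ : ℝ → E →L[ℝ] ℝ} {T T' : Fin n → ℝ} {p : ℝ → E →L[ℝ] ℝ}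

/-- The integrand of the duality between a costate and a solution. -/
theorem IsTubeSystem.costate_apply_eq_integral [CompleteSpace E]
    (h : IsTubeSystem t₀ t₁ r P Q DP DQ)
    (h01 : t₀ ≤ t₁) (hℓ : UniformC1 t₀ t₁ r ℓ Dℓ) (hpc : ContinuousOn p (Icc t₀ t₁))
    (hp : ∀ s ∈ Ioo t₀ t₁, s ∉ range (times t₀ t₁ T) →
      HasDerivAt p (-(p s ∘L tubeLinearization t₀ t₁ DP DQ T s) - Dℓ s) s)
    {x : ℝ → E} (hx : IsTubeSolution t₀ t₁ r P Q T T' t₁ x) :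
    IntervalIntegrable (fun s => p s (tubeField t₀ t₁ P Q T T' s (x s)
        - tubeLinearization t₀ t₁ DP DQ T s (x s)) - Dℓ s (x s)) volume t₀ t₁ ∧
      p t₁ (x t₁) = ∫ s in t₀..t₁, (p s (tubeField t₀ t₁ P Q T T' s (x s)
        - tubeLinearization t₀ t₁ DP DQ T s (x s)) - Dℓ s (x s)) := by
  have hu : uIcc t₀ t₁ = Icc t₀ t₁ := uIcc_of_le h01
  have hint : IntervalIntegrable (fun s => p s (tubeField t₀ t₁ P Q T T' s (x s)
        - tubeLinearization t₀ t₁ DP DQ T s (x s)) - Dℓ s (x s)) volume t₀ t₁ := by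
    have e : (fun s => p s (tubeField t₀ t₁ P Q T T' s (x s)
        - tubeLinearization t₀ t₁ DP DQ T s (x s)) - Dℓ s (x s))
        = fun s => (∑ k, fun s => (modeWeight t₀ t₁ T' k s • p s (P k s (x s))
          - modeWeight t₀ t₁ T k s • (p s (Q k s (x s)) + p s ((DP k s - DQ k s) (x s))))) s
          - Dℓ s (x s) := by
      ext s
      simp only [tubeField, tubeLinearization, map_sub, map_sum, Finset.sum_apply,
        sum_apply, smul_apply, map_smul, smul_add,
        sub_add_eq_sub_sub, Finset.sum_sub_distrib]
    rw [e]
    refine IntervalIntegrable.sub (IntervalIntegrable.sum _ fun k _ =>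
      (intervalIntegrable_modeWeight_smul T' k (ContinuousOn.intervalIntegrable ?_)).sub
      (intervalIntegrable_modeWeight_smul T k (ContinuousOn.intervalIntegrable ?_)))
      (ContinuousOn.intervalIntegrable ?_)
    · rw [hu]
      exact hpc.clm_apply ((h.left k).continuousOn_comp le_rfl hx.continuousOn hx.norm_le)
    · rw [hu]
      exact (hpc.clm_apply ((h.right k).continuousOn_comp le_rfl hx.continuousOn hx.norm_le)).add
        (hpc.clm_apply (((h.left k).continuousOn_deriv.sub
          (h.right k).continuousOn_deriv).clm_apply hx.continuousOn))
    · rw [hu]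
      exact hℓ.continuousOn_deriv.clm_apply hx.continuousOn
  refine ⟨hint, ?_⟩
  have hx0 : x t₀ = 0 := by
    rw [hx.eq_integral t₀ (left_mem_Icc.2 h01), intervalIntegral.integral_same]
  have := integral_eq_of_hasDerivAt_off_countable_of_le (fun s => p s (x s)) _ h01
    (s := range (times t₀ t₁ T) ∪ range (times t₀ t₁ T'))
    ((countable_range _).union (countable_range _))
    (hpc.clm_apply hx.continuousOn) (fun s hs => ?_) hint
  · rw [this]; simp [hx0]
  · have hs1 : s ∉ range (times t₀ t₁ T) := fun h' => hs.2 (Or.inl h')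
    have hs2 : s ∉ range (times t₀ t₁ T') := fun h' => hs.2 (Or.inr h')
    convert! (hp s hs.1 hs1).clm_apply (h.hasDerivAt hx hs.1 hs1 hs2) using 1
    simp
    ring

/-- First-order expansion of the cost `∫ ℓ(s, x(s)) ds + ψ(x(t₁))` along solutions of perturbed
systems, with the costate as Lagrange multiplier. -/
theorem IsTubeSystem.cost_expansion [CompleteSpace E] (h : IsTubeSystem t₀ t₁ r P Q DP DQ)
    (h01 : t₀ ≤ t₁) (hℓ : UniformC1 t₀ t₁ r ℓ Dℓ) {ψ : E → ℝ} (hψ : HasFDerivAt ψ (p t₁) 0)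
    (hpc : ContinuousOn p (Icc t₀ t₁))
    (hp : ∀ s ∈ Ioo t₀ t₁, s ∉ range (times t₀ t₁ T) →
      HasDerivAt p (-(p s ∘L tubeLinearization t₀ t₁ DP DQ T s) - Dℓ s) s) {c : ℝ} (hc : 0 < c) :
    ∃ η > 0, ∀ T', ‖T' - T‖ ≤ η → ∀ x, IsTubeSolution t₀ t₁ r P Q T T' t₁ x →
      |((∫ s in t₀..t₁, ℓ s (x s)) + ψ (x t₁)) - ((∫ s in t₀..t₁, ℓ s 0) + ψ 0)
        - ((∑ k, ∫ s in t₀..t₁, modeWeight t₀ t₁ T' k s * p s (P k s 0))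
          - ∑ k, ∫ s in t₀..t₁, modeWeight t₀ t₁ T k s * p s (P k s 0))| ≤ c * ‖T' - T‖ := by
  have hu : uIcc t₀ t₁ = Icc t₀ t₁ := uIcc_of_le h01
  obtain ⟨K, hK, hPK, -⟩ := h.exists_lipschitz
  obtain ⟨C, hC, hCx⟩ := h.exists_norm_le h01
  obtain ⟨B', hB'⟩ := isCompact_Icc.exists_bound_of_continuousOn hpc
  obtain ⟨B, hB, hpB⟩ : ∃ B, 0 ≤ B ∧ ∀ s ∈ Icc t₀ t₁, ‖p s‖ ≤ B :=
    ⟨|B'|, abs_nonneg _, fun s hs => (hB' s hs).trans (le_abs_self _)⟩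
  set N : ℝ := 2 * (n + 1) with hN
  have hN0 : 0 ≤ N := by positivity
  have hd : 0 ≤ t₁ - t₀ := sub_nonneg.2 h01
  obtain ⟨ε, hε, hεc⟩ := exists_pos_mul_lt (half_pos hc) (C * ((1 + B * N) * (t₁ - t₀) + 1))
  obtain ⟨η₀, hη₀, hη₀c⟩ := exists_pos_mul_lt (half_pos hc) (C * (B * K * N))
  obtain ⟨ρ, ⟨⟨hρP, hρQ⟩, hρℓ, hρψ⟩, hρ⟩ := (((eventually_all.2 fun k =>
    (h.left k).eventually_approx hε).and (eventually_all.2 fun k =>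
    (h.right k).eventually_approx hε)).and ((hℓ.eventually_approx hε).and
    (show ∀ᶠ ρ in 𝓝[>] (0 : ℝ), ∀ x, ‖x‖ ≤ ρ → ‖ψ x - ψ 0 - p t₁ x‖ ≤ ε * ‖x‖ by
      obtain ⟨δ, hδ, H⟩ := Metric.eventually_nhds_iff.1
        ((hasFDerivAt_iff_isLittleO_nhds_zero.1 hψ).def hε)
      filter_upwards [Ioo_mem_nhdsGT hδ] with ρ hρ x hx
      simpa using @H x (by simpa using hx.trans_lt hρ.2)))).and self_mem_nhdsWithin |>.exists
  obtain ⟨η₁, hη₁, hη₁ρ⟩ := exists_pos_mul_lt (show (0 : ℝ) < ρ from hρ) C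
  refine ⟨min η₀ η₁, lt_min hη₀ hη₁, fun T' hT' x hx => ?_⟩
  set δ := ‖T' - T‖ with hδ
  have hδ0 : 0 ≤ δ := norm_nonneg _
  have hxδ : ∀ s ∈ Icc t₀ t₁, ‖x s‖ ≤ C * δ := hCx T T' t₁ (right_mem_Icc.2 h01) x hx
  have hxρ : ∀ s ∈ Icc t₀ t₁, ‖x s‖ ≤ ρ := fun s hs => (hxδ s hs).trans
    ((mul_le_mul_of_nonneg_left (hT'.trans (min_le_right _ _)) hC).trans hη₁ρ.le)
  obtain ⟨hint, hdual⟩ := h.costate_apply_eq_integral h01 hℓ hpc hp hx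
  have hi1 : IntervalIntegrable (fun s => ℓ s (x s)) volume t₀ t₁ := by
    refine ContinuousOn.intervalIntegrable ?_
    rw [hu]; exact hℓ.continuousOn_comp le_rfl hx.continuousOn hx.norm_le
  have hi2 : IntervalIntegrable (fun s => ℓ s 0) volume t₀ t₁ := by
    refine ContinuousOn.intervalIntegrable ?_
    rw [hu]
    exact hℓ.continuousOn_comp (x := fun _ => 0) le_rfl continuousOn_const
      fun _ _ => by simpa using h.pos.le
  have hi3 : ∀ (T : Fin n → ℝ) (k : Fin (n + 1)), IntervalIntegrable
      (fun s => modeWeight t₀ t₁ T k s * p s (P k s 0)) volume t₀ t₁ := fun T k => by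
    refine intervalIntegrable_modeWeight_smul T k (ContinuousOn.intervalIntegrable ?_)
    rw [hu]
    exact hpc.clm_apply (h.continuousOn_left_zero k)
  have hi4 : ∀ T : Fin n → ℝ, IntervalIntegrable
      (fun s => ∑ k, modeWeight t₀ t₁ T k s * p s (P k s 0)) volume t₀ t₁ := fun T => by
    simpa only [Finset.sum_fn] using IntervalIntegrable.sum _ fun k _ => hi3 T k
  rw [← intervalIntegral.integral_finsetSum fun k _ => hi3 T' k,
    ← intervalIntegral.integral_finsetSum fun k _ => hi3 T k]
  have hsplit : ((∫ s in t₀..t₁, ℓ s (x s)) + ψ (x t₁)) - ((∫ s in t₀..t₁, ℓ s 0) + ψ 0)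
        - ((∫ s in t₀..t₁, ∑ k, modeWeight t₀ t₁ T' k s * p s (P k s 0))
          - ∫ s in t₀..t₁, ∑ k, modeWeight t₀ t₁ T k s * p s (P k s 0))
      = (ψ (x t₁) - ψ 0 - p t₁ (x t₁)) + ∫ s in t₀..t₁, (ℓ s (x s) - ℓ s 0
        + (p s (tubeField t₀ t₁ P Q T T' s (x s)
          - tubeLinearization t₀ t₁ DP DQ T s (x s)) - Dℓ s (x s))
        - ((∑ k, modeWeight t₀ t₁ T' k s * p s (P k s 0))
          - ∑ k, modeWeight t₀ t₁ T k s * p s (P k s 0))) := by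
    rw [intervalIntegral.integral_sub ((hi1.sub hi2).add hint) ((hi4 T').sub (hi4 T)),
      intervalIntegral.integral_add (hi1.sub hi2) hint, intervalIntegral.integral_sub hi1 hi2,
      intervalIntegral.integral_sub (hi4 T') (hi4 T), ← hdual]
    ring
  have hmain : ‖∫ s in t₀..t₁, (ℓ s (x s) - ℓ s 0
        + (p s (tubeField t₀ t₁ P Q T T' s (x s)
          - tubeLinearization t₀ t₁ DP DQ T s (x s)) - Dℓ s (x s))
        - ((∑ k, modeWeight t₀ t₁ T' k s * p s (P k s 0))
          - ∑ k, modeWeight t₀ t₁ T k s * p s (P k s 0)))‖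
      ≤ ∫ s in t₀..t₁, C * δ * (ε * (1 + B * N)
        + B * K * ∑ k, |modeWeight t₀ t₁ T' k s - modeWeight t₀ t₁ T k s|) := by
    refine intervalIntegral.norm_integral_le_of_norm_le h01 (ae_of_all _ fun s hs => ?_) ?_
    · have hs' : s ∈ Icc t₀ t₁ := ⟨hs.1.le, hs.2⟩
      have hpv : ∀ v, ‖p s v‖ ≤ B * ‖v‖ := fun v => (p s).le_of_opNorm_le (hpB s hs') v
      have e : ℓ s (x s) - ℓ s 0
        + (p s (tubeField t₀ t₁ P Q T T' s (x s)
          - tubeLinearization t₀ t₁ DP DQ T s (x s)) - Dℓ s (x s))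
        - ((∑ k, modeWeight t₀ t₁ T' k s * p s (P k s 0))
          - ∑ k, modeWeight t₀ t₁ T k s * p s (P k s 0))
        = (ℓ s (x s) - ℓ s 0 - Dℓ s (x s))
          + ∑ k, ((modeWeight t₀ t₁ T' k s - modeWeight t₀ t₁ T k s)
              * p s (P k s (x s) - P k s 0)
            + modeWeight t₀ t₁ T k s * p s (P k s (x s) - P k s 0 - DP k s (x s))
            - modeWeight t₀ t₁ T k s * p s (Q k s (x s) - Q k s 0 - DQ k s (x s))) := by
        have e1 : p s (tubeField t₀ t₁ P Q T T' s (x s)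
            - tubeLinearization t₀ t₁ DP DQ T s (x s))
            = ∑ k, (modeWeight t₀ t₁ T' k s * p s (P k s (x s))
              - modeWeight t₀ t₁ T k s * p s (Q k s (x s))
              - modeWeight t₀ t₁ T k s * (p s (DP k s (x s)) - p s (DQ k s (x s)))) := by
          simp only [tubeField, tubeLinearization, map_sub, map_sum,
            sum_apply, smul_apply, map_smul,
            sub_apply, smul_eq_mul, Finset.sum_sub_distrib]
        rw [e1, ← Finset.sum_sub_distrib]
        have e2 : ∀ a b c S₁ S₂ S₃ : ℝ, S₁ - S₂ = S₃ → a - b + (S₁ - c) - S₂ = a - b - c + S₃ := by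
          intro a b c S₁ S₂ S₃ h; linarith
        refine e2 _ _ _ _ _ _ ?_
        rw [← Finset.sum_sub_distrib]
        refine Finset.sum_congr rfl fun k _ => ?_
        simp only [map_sub, h.agree k s hs']
        ring
      rw [e]
      have hterm : ∀ k, ‖(modeWeight t₀ t₁ T' k s - modeWeight t₀ t₁ T k s)
              * p s (P k s (x s) - P k s 0)
            + modeWeight t₀ t₁ T k s * p s (P k s (x s) - P k s 0 - DP k s (x s))
            - modeWeight t₀ t₁ T k s * p s (Q k s (x s) - Q k s 0 - DQ k s (x s))‖
          ≤ |modeWeight t₀ t₁ T' k s - modeWeight t₀ t₁ T k s| * (B * (K * ‖x s‖))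
            + B * (ε * ‖x s‖) + B * (ε * ‖x s‖) := by
        intro k
        refine (norm_sub_le _ _).trans (add_le_add ((norm_add_le _ _).trans (add_le_add ?_ ?_)) ?_)
        · rw [norm_mul, Real.norm_eq_abs]
          refine mul_le_mul_of_nonneg_left ((hpv _).trans (mul_le_mul_of_nonneg_left ?_ hB))
            (abs_nonneg _)
          simpa using hPK k s hs' (x s) (by simpa using hx.norm_le s hs') 0 h.zero_mem
        · rw [norm_mul, Real.norm_eq_abs]
          exact (mul_le_of_le_one_left (norm_nonneg _) (abs_modeWeight_le T k s)).trans
            ((hpv _).trans (mul_le_mul_of_nonneg_left (hρP k s hs' _ (hxρ s hs')) hB))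
        · rw [norm_mul, Real.norm_eq_abs]
          exact (mul_le_of_le_one_left (norm_nonneg _) (abs_modeWeight_le T k s)).trans
            ((hpv _).trans (mul_le_mul_of_nonneg_left (hρQ k s hs' _ (hxρ s hs')) hB))
      calc _ ≤ ε * ‖x s‖ + ∑ k, (|modeWeight t₀ t₁ T' k s - modeWeight t₀ t₁ T k s|
              * (B * (K * ‖x s‖)) + B * (ε * ‖x s‖) + B * (ε * ‖x s‖)) :=
            (norm_add_le _ _).trans (add_le_add (hρℓ s hs' _ (hxρ s hs'))
              (norm_sum_le_of_le _ fun k _ => hterm k))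
        _ = ‖x s‖ * (ε * (1 + B * N)
              + B * K * ∑ k, |modeWeight t₀ t₁ T' k s - modeWeight t₀ t₁ T k s|) := by
            rw [Finset.sum_add_distrib, Finset.sum_add_distrib, ← Finset.sum_mul]
            simp only [Finset.sum_const, Finset.card_univ, Fintype.card_fin, nsmul_eq_mul]
            push_cast
            rw [hN]
            ring
        _ ≤ _ := by
            refine mul_le_mul_of_nonneg_right (hxδ s hs') ?_
            have := Finset.sum_nonneg (s := Finset.univ) fun (k : Fin (n + 1)) _ =>
              abs_nonneg (modeWeight t₀ t₁ T' k s - modeWeight t₀ t₁ T k s)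
            positivity
    · refine (intervalIntegrable_const.add (IntervalIntegrable.const_mul ?_ _)).const_mul _
      simpa only [Finset.sum_fn] using
        IntervalIntegrable.sum _ fun k _ => intervalIntegrable_abs_modeWeight_sub T T' k t₀ t₁
  have hbound : ∫ s in t₀..t₁, C * δ * (ε * (1 + B * N)
        + B * K * ∑ k, |modeWeight t₀ t₁ T' k s - modeWeight t₀ t₁ T k s|)
      ≤ C * δ * (ε * (1 + B * N) * (t₁ - t₀) + B * K * (N * δ)) := by
    have hi5 : IntervalIntegrable (fun s =>
        ∑ k, |modeWeight t₀ t₁ T' k s - modeWeight t₀ t₁ T k s|) volume t₀ t₁ := by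
      simpa only [Finset.sum_fn] using
        IntervalIntegrable.sum _ fun k _ => intervalIntegrable_abs_modeWeight_sub T T' k t₀ t₁
    rw [intervalIntegral.integral_const_mul, intervalIntegral.integral_add
      intervalIntegrable_const (hi5.const_mul _), intervalIntegral.integral_const,
      intervalIntegral.integral_const_mul, intervalIntegral.integral_finsetSum
      fun k _ => intervalIntegrable_abs_modeWeight_sub T T' k t₀ t₁, smul_eq_mul,
      mul_comm (t₁ - t₀)]
    gcongr
    refine (Finset.sum_le_sum fun k _ => integral_abs_modeWeight_sub_le h01 T T' k).trans_eq ?_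
    simp only [Finset.sum_const, Finset.card_univ, Fintype.card_fin, nsmul_eq_mul]
    push_cast
    rw [hN]
    ring
  rw [hsplit]
  have hψx := hρψ (x t₁) (hxρ t₁ (right_mem_Icc.2 h01))
  have hx1 := hxδ t₁ (right_mem_Icc.2 h01)
  calc _ ≤ ε * ‖x t₁‖ + C * δ * (ε * (1 + B * N) * (t₁ - t₀) + B * K * (N * δ)) :=
        (norm_add_le _ _).trans (add_le_add hψx (hmain.trans hbound))
    _ ≤ ε * (C * δ) + C * δ * (ε * (1 + B * N) * (t₁ - t₀) + B * K * (N * δ)) := by gcongr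
    _ = (C * ((1 + B * N) * (t₁ - t₀) + 1) * ε + C * (B * K * N) * δ) * δ := by ring
    _ ≤ (c / 2 + C * (B * K * N) * η₀) * δ := by
        gcongr
        exact hT'.trans (min_le_left _ _)
    _ ≤ (c / 2 + c / 2) * δ := by gcongr
    _ = c * δ := by ring

/-- The derivative of a function of the transition times which, near `T`, is the cost of solutions
of the perturbed systems. -/
theorem IsTubeSystem.hasFDerivWithinAt_cost [CompleteSpace E]
    (h : IsTubeSystem t₀ t₁ r P Q DP DQ) (hT : T ∈ admissible n t₀ t₁)
    (hℓ : UniformC1 t₀ t₁ r ℓ Dℓ) {ψ : E → ℝ} (hψ : HasFDerivAt ψ (p t₁) 0)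
    (hpc : ContinuousOn p (Icc t₀ t₁))
    (hp : ∀ s ∈ Ioo t₀ t₁, s ∉ range (times t₀ t₁ T) →
      HasDerivAt p (-(p s ∘L tubeLinearization t₀ t₁ DP DQ T s) - Dℓ s) s)
    {J : (Fin n → ℝ) → ℝ}
    (hJ : ∀ᶠ T' in 𝓝[admissible n t₀ t₁] T, ∃ x, IsTubeSolution t₀ t₁ r P Q T T' t₁ x ∧
      J T' = (∫ s in t₀..t₁, ℓ s (x s)) + ψ (x t₁)) :
    HasFDerivWithinAt J
      (∑ i : Fin n, (p (T i) (P i.castSucc (T i) 0) - p (T i) (P i.succ (T i) 0)) •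
          (ContinuousLinearMap.proj i : (Fin n → ℝ) →L[ℝ] ℝ)) (admissible n t₀ t₁) T := by
  have h01 := le_of_admissible hT
  have hS := hasFDerivWithinAt_sum_integral_modeWeight hT (u := fun k s => p s (P k s 0))
    fun k => hpc.clm_apply (h.continuousOn_left_zero k)
  have hJT : J T = (∫ s in t₀..t₁, ℓ s 0) + ψ 0 := by
    obtain ⟨x, hx, hxJ⟩ := hJ.self_of_nhdsWithin hT
    obtain ⟨C, -, hC⟩ := h.exists_norm_le h01
    have hx0 : ∀ s ∈ Icc t₀ t₁, x s = 0 := fun s hs => by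
      simpa using hC T T t₁ (right_mem_Icc.2 h01) x hx s hs
    rw [hxJ, hx0 t₁ (right_mem_Icc.2 h01)]
    congr 1
    refine intervalIntegral.integral_congr fun s hs => ?_
    rw [uIcc_of_le h01] at hs
    simp only [hx0 s hs]
  have hdiff : HasFDerivWithinAt
      (fun T' => J T' - ∑ k, ∫ s in t₀..t₁, modeWeight t₀ t₁ T' k s * p s (P k s 0))
      (0 : (Fin n → ℝ) →L[ℝ] ℝ) (admissible n t₀ t₁) T := by
    refine HasFDerivWithinAt.of_isLittleO (Asymptotics.isLittleO_iff.2 fun c hc => ?_)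
    obtain ⟨η, hη, H⟩ := h.cost_expansion h01 hℓ hψ hpc hp hc
    filter_upwards [hJ, mem_nhdsWithin_of_mem_nhds (Metric.closedBall_mem_nhds T hη)]
      with T' ⟨x, hx, hxJ⟩ hT'
    have := H T' (by simpa [dist_eq_norm] using hT') x hx
    rw [← hxJ, ← hJT] at this
    simp only [zero_apply, sub_zero, Real.norm_eq_abs]
    rwa [sub_sub_sub_comm]
  have hsum := hdiff.add hS
  rw [zero_add] at hsum
  exact hsum.congr (fun T' _ => by simp) (by simp)

/-- Existence of the costate for a linear adjoint equation with jumps in the coefficients. -/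
theorem exists_costate [CompleteSpace E] (h01 : t₀ ≤ t₁) {D : Fin (n + 1) → ℝ → E →L[ℝ] E}
    (hD : ∀ k, ContinuousOn (D k) (Icc t₀ t₁)) (hℓ : ContinuousOn Dℓ (Icc t₀ t₁))
    (T : Fin n → ℝ) (p₁ : E →L[ℝ] ℝ) :
    ∃ p : ℝ → E →L[ℝ] ℝ, ContinuousOn p (Icc t₀ t₁) ∧ p t₁ = p₁ ∧
      ∀ s ∈ Ioo t₀ t₁, s ∉ range (times t₀ t₁ T) →
      HasDerivAt p (-(p s ∘L ∑ k, modeWeight t₀ t₁ T k s • D k s) - Dℓ s) s := by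
  have hu : uIcc t₀ t₁ = Icc t₀ t₁ := uIcc_of_le h01
  choose M hM using fun k => isCompact_Icc.exists_bound_of_continuousOn (hD k)
  have hM0 : ∀ k, 0 ≤ M k := fun k =>
    (norm_nonneg _).trans (hM k t₀ (left_mem_Icc.2 h01))
  let A : ℝ → E →L[ℝ] E := fun s => ∑ k, modeWeight t₀ t₁ T k s • D k s
  have hA : ∀ s ∈ Icc t₀ t₁, ‖A s‖ ≤ ∑ k, M k := fun s hs => by
    refine norm_sum_le_of_le _ fun k _ => ?_
    rw [norm_smul]
    exact (mul_le_of_le_one_left (norm_nonneg _) (abs_modeWeight_le T k s)).trans (hM k s hs)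
  have hint : ∀ q : ℝ → E →L[ℝ] ℝ, ContinuousOn q (Icc t₀ t₁) →
      IntervalIntegrable (fun s => q s ∘L A s + Dℓ s) volume t₀ t₁ := fun q hq => by
    have e : (fun s => q s ∘L A s + Dℓ s)
        = fun s => (∑ k, fun s => modeWeight t₀ t₁ T k s • (q s ∘L D k s)) s + Dℓ s := by
      ext s v
      simp [A]
    rw [e]
    have h1 : ∀ k, ContinuousOn (fun s => q s ∘L D k s) (uIcc t₀ t₁) := fun k => by
      rw [hu]; exact hq.clm_comp (hD k)
    have h2 : IntervalIntegrable Dℓ volume t₀ t₁ :=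
      ContinuousOn.intervalIntegrable (by rwa [hu])
    exact (IntervalIntegrable.sum Finset.univ fun k _ =>
      intervalIntegrable_modeWeight_smul T k (h1 k).intervalIntegrable).add h2
  have hrefl : MapsTo (fun s => t₀ + t₁ - s) (Icc t₀ t₁) (Icc t₀ t₁) := fun s hs =>
    ⟨by linarith [hs.2], by linarith [hs.1]⟩
  have hcr : Continuous fun s : ℝ => t₀ + t₁ - s := by fun_prop
  obtain ⟨q, hq, hqeq⟩ := exists_solution_integral_equation (K := ∑ k, M k) h01
    (Finset.sum_nonneg fun k _ => hM0 k)
    (F := fun s q => q ∘L A (t₀ + t₁ - s) + Dℓ (t₀ + t₁ - s))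
    (fun s hs x y => by
      rw [add_sub_add_right_eq_sub, ← ContinuousLinearMap.sub_comp, mul_comm]
      exact (ContinuousLinearMap.opNorm_comp_le _ _).trans
        (mul_le_mul_of_nonneg_left (hA _ (hrefl hs)) (norm_nonneg _)))
    (fun q hq => by
      have := (hint (fun s => q (t₀ + t₁ - s)) (hq.comp hcr).continuousOn).comp_sub_left (t₀ + t₁)
      simp only [sub_sub_cancel, add_sub_cancel_left, add_sub_cancel_right] at this
      exact this.symm) p₁
  let p : ℝ → E →L[ℝ] ℝ := fun s => q (t₀ + t₁ - s)
  have hpc : Continuous p := hq.comp hcr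
  have hpeq : ∀ t ∈ Icc t₀ t₁, p t
      = (p₁ + ∫ s in t₀..t₁, (p s ∘L A s + Dℓ s)) + ∫ s in t₀..t, -(p s ∘L A s + Dℓ s) := by
    intro t ht
    have e := hqeq (t₀ + t₁ - t) (hrefl ht)
    have e2 := intervalIntegral.integral_comp_sub_left (a := t₀) (b := t₀ + t₁ - t)
      (fun s => p s ∘L A s + Dℓ s) (t₀ + t₁)
    simp only [p, sub_sub_cancel, add_sub_cancel_left] at e2
    rw [e2] at e
    have hi := hint p hpc.continuousOn
    have hit : IntervalIntegrable (fun s => p s ∘L A s + Dℓ s) volume t₀ t := hi.mono_set (by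
      rw [uIcc_of_le ht.1, hu]; exact Icc_subset_Icc_right ht.2)
    rw [intervalIntegral.integral_neg, add_assoc, ← sub_eq_add_neg,
      intervalIntegral.integral_interval_sub_left hi hit]
    exact e
  refine ⟨p, hpc.continuousOn, ?_, fun s hs hsT => ?_⟩
  · simpa [p] using hqeq t₀ (left_mem_Icc.2 h01)
  · have hmem : Icc t₀ t₁ ∈ 𝓝 s := Icc_mem_nhds hs.1 hs.2
    have hAc : ContinuousAt A s := tendsto_finsetSum _ fun k _ =>
      ((continuousAt_const (y := modeWeight t₀ t₁ T k s)).congr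
        ((modeWeight_eventuallyEq hsT k).mono fun _ hs => hs.symm)).smul ((hD k).continuousAt hmem)
    have hv : ContinuousAt (fun s => -(p s ∘L A s + Dℓ s)) s :=
      ((hpc.continuousAt.clm_comp hAc).add (hℓ.continuousAt hmem)).neg
    have := hasDerivAt_of_eq_add_integral (hint p hpc.continuousOn).neg hpeq hs hv
    simp only [Pi.neg_apply] at this
    rwa [neg_add, ← sub_eq_add_neg] at this

end Costate

theorem hasDerivAt_of_eventually_hasDerivAt_of_ne {E : Type*} [NormedAddCommGroup E]
    [NormedSpace ℝ E] {f g : ℝ → E} {t : ℝ} (hd : ∀ᶠ s in 𝓝[≠] t, HasDerivAt f (g s) s)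
    (hf : ContinuousAt f t) (hg : ContinuousAt g t) : HasDerivAt f (g t) t := by
  rw [← nhdsLT_sup_nhdsGT, eventually_sup] at hd
  have A : HasDerivWithinAt f (g t) (Ici t) t :=
    hasDerivWithinAt_Ici_of_tendsto_deriv
      (fun s (hs : HasDerivAt f (g s) s) => hs.differentiableAt.differentiableWithinAt)
      hf.continuousWithinAt hd.2
      ((hg.mono_left inf_le_left).congr' (hd.2.mono fun s hs => hs.deriv.symm))
  have B : HasDerivWithinAt f (g t) (Iic t) t :=
    hasDerivWithinAt_Iic_of_tendsto_deriv
      (fun s (hs : HasDerivAt f (g s) s) => hs.differentiableAt.differentiableWithinAt)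
      hf.continuousWithinAt hd.1
      ((hg.mono_left inf_le_left).congr' (hd.1.mono fun s hs => hs.deriv.symm))
  simpa using B.union A

section LieGroup

variable {E : Type*} [NormedAddCommGroup E] [NormedSpace ℝ E]
  {H : Type*} [TopologicalSpace H] (I : ModelWithCorners ℝ E H)
  {G : Type*} [TopologicalSpace G] [ChartedSpace H G]

/-- The curve `γ` has velocity `v` at time `t`, with `v` read in the preferred chart at `γ t`. -/
def HasVelocityAt (γ : ℝ → G) (v : E) (t : ℝ) : Prop :=
  HasMFDerivAt 𝓘(ℝ, ℝ) I γ t ((1 : ℝ →L[ℝ] ℝ).smulRight v : ℝ →L[ℝ] E)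

variable {I} in
theorem HasVelocityAt.congr_of_eventuallyEq {γ δ : ℝ → G} {v : E} {t : ℝ}
    (h : HasVelocityAt I γ v t) (he : δ =ᶠ[𝓝 t] γ) : HasVelocityAt I δ v t :=
  HasMFDerivAt.congr_of_eventuallyEq h he

variable {I} in
theorem HasVelocityAt.unique {γ : ℝ → G} {v w : E} {t : ℝ}
    (h : HasVelocityAt I γ v t) (h' : HasVelocityAt I γ w t) : v = w := by
  have e : ((1 : ℝ →L[ℝ] ℝ).smulRight v : ℝ →L[ℝ] E) = (1 : ℝ →L[ℝ] ℝ).smulRight w :=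
    hasMFDerivAt_unique h h'
  simpa using DFunLike.congr_fun e 1

variable {I} in
theorem HasVelocityAt.comp {E' : Type*} [NormedAddCommGroup E'] [NormedSpace ℝ E']
    {H' : Type*} [TopologicalSpace H'] {I' : ModelWithCorners ℝ E' H'}
    {M' : Type*} [TopologicalSpace M'] [ChartedSpace H' M'] {γ : ℝ → G} {v : E} {t : ℝ}
    (h : HasVelocityAt I γ v t) {F : G → M'} {D : E →L[ℝ] E'} (hF : HasMFDerivAt I I' F (γ t) D) :
    HasVelocityAt I' (fun s => F (γ s)) (D v) t := by
  have e : D ∘L ((1 : ℝ →L[ℝ] ℝ).smulRight v) = (1 : ℝ →L[ℝ] ℝ).smulRight (D v) := by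
    ext; simp
  have := HasMFDerivAt.comp t hF h
  rw [HasVelocityAt, ← e]
  exact this

theorem hasVelocityAt_iff_hasDerivAt {x : ℝ → E} {v : E} {t : ℝ} :
    HasVelocityAt 𝓘(ℝ, E) x v t ↔ HasDerivAt x v t := by
  rw [HasVelocityAt, hasDerivAt_iff_hasFDerivAt]
  exact hasMFDerivAt_iff_hasFDerivAt

variable [Group G]

/-- The derivative at `h` of the left translation by `g`, read in the preferred charts. -/
def leftTrans (g h : G) : E →L[ℝ] E := mfderiv I I (fun k : G => g * k) h

/-- The derivative at `h` of the right translation by `g`, read in the preferred charts. -/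
def rightTrans (g h : G) : E →L[ℝ] E := mfderiv I I (fun k : G => k * g) h

variable [LieGroup I ∞ G]

theorem hasMFDerivAt_leftTrans (g h : G) :
    HasMFDerivAt I I (fun k : G => g * k) h (leftTrans I g h : E →L[ℝ] E) :=
  ((contMDiff_mul_left (I := I) (n := ∞) (a := g)).mdifferentiableAt (by simp)).hasMFDerivAt

theorem hasMFDerivAt_rightTrans (g h : G) :
    HasMFDerivAt I I (fun k : G => k * g) h (rightTrans I g h : E →L[ℝ] E) :=
  ((contMDiff_mul_right (I := I) (n := ∞) (a := g)).mdifferentiableAt (by simp)).hasMFDerivAt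

theorem leftTrans_comp (a b c : G) (v : E) :
    leftTrans I a (b * c) (leftTrans I b c v) = leftTrans I (a * b) c v := by
  have h := HasMFDerivAt.comp c (hasMFDerivAt_leftTrans I a (b * c)) (hasMFDerivAt_leftTrans I b c)
  have e : (fun k : G => a * k) ∘ (fun k => b * k) = fun k => (a * b) * k := by
    ext k; simp [mul_assoc]
  rw [e] at h
  exact DFunLike.congr_fun (hasMFDerivAt_unique h (hasMFDerivAt_leftTrans I (a * b) c)) v

theorem leftTrans_one (c : G) (v : E) : leftTrans I (1 : G) c v = v := by
  have h := hasMFDerivAt_leftTrans I (1 : G) c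
  have e : (fun k : G => (1 : G) * k) = id := by ext k; simp
  rw [e] at h
  exact DFunLike.congr_fun (hasMFDerivAt_unique h (hasMFDerivAt_id c)) v

theorem leftTrans_injective (a b : G) : Injective (leftTrans I a b) := by
  intro v w hvw
  have h := congrArg (leftTrans I a⁻¹ (a * b)) hvw
  rwa [leftTrans_comp, leftTrans_comp, inv_mul_cancel, leftTrans_one, leftTrans_one] at h

theorem rightTrans_leftTrans (a b c : G) (v : E) :
    rightTrans I b (a * c) (leftTrans I a c v) = leftTrans I a (c * b) (rightTrans I b c v) := by
  have h1 := HasMFDerivAt.comp c (hasMFDerivAt_rightTrans I b (a * c))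
    (hasMFDerivAt_leftTrans I a c)
  have h2 := HasMFDerivAt.comp c (hasMFDerivAt_leftTrans I a (c * b))
    (hasMFDerivAt_rightTrans I b c)
  have e : (fun k : G => k * b) ∘ (fun k => a * k) = (fun k => a * k) ∘ fun k => k * b := by
    ext k; simp [mul_assoc]
  rw [e] at h1
  exact DFunLike.congr_fun (hasMFDerivAt_unique h1 h2) v

variable {I} in
theorem HasVelocityAt.mul {g h : ℝ → G} {v w : E} {t : ℝ} (hg : HasVelocityAt I g v t)
    (hh : HasVelocityAt I h w t) :
    HasVelocityAt I (fun s => g s * h s)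
      (rightTrans I (h t) (g t) v + leftTrans I (g t) (h t) w) t := by
  have hm : MDifferentiableAt (I.prod I) I (fun p : G × G => p.1 * p.2) (g t, h t) :=
    (contMDiff_mul I ∞).mdifferentiableAt (by simp)
  have hp : HasVelocityAt (I.prod I) (fun s => (g s, h s)) (v, w) t := by
    have := HasMFDerivAt.prodMk hg hh
    have e : ((1 : ℝ →L[ℝ] ℝ).smulRight v).prod ((1 : ℝ →L[ℝ] ℝ).smulRight w)
        = (1 : ℝ →L[ℝ] ℝ).smulRight (v, w) := by ext <;> simp
    rw [HasVelocityAt, ← e]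
    exact this
  have := hp.comp (F := fun p : G × G => p.1 * p.2) hm.hasMFDerivAt
  have e : rightTrans I (h t) (g t) v + leftTrans I (g t) (h t) w
      = (mfderiv (I.prod I) I (fun p : G × G => p.1 * p.2) (g t, h t) : E × E →L[ℝ] E) (v, w) :=
    (mfderiv_prod_eq_add_apply (v := (v, w)) hm).symm
  rw [e]
  exact this

variable {I} in
theorem HasVelocityAt.exists_inv_mul {g h : ℝ → G} {v w : E} {t : ℝ} (hg : HasVelocityAt I g v t)
    (hh : HasVelocityAt I h w t) : ∃ u, HasVelocityAt I (fun s => (g s)⁻¹ * h s) u t := by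
  have hi : MDifferentiableAt I I (fun p : G => p⁻¹) (g t) :=
    (contMDiff_inv I ∞).mdifferentiableAt (by simp)
  exact ⟨_, (hg.comp (F := fun p : G => p⁻¹) hi.hasMFDerivAt).mul hh⟩

end LieGroup

theorem hasMFDerivAt_comp_of_model {E E' E'' : Type*} [NormedAddCommGroup E] [NormedSpace ℝ E]
    [NormedAddCommGroup E'] [NormedSpace ℝ E'] [NormedAddCommGroup E''] [NormedSpace ℝ E'']
    {H H' H'' : Type*} [TopologicalSpace H] [TopologicalSpace H'] [TopologicalSpace H'']
    {I : ModelWithCorners ℝ E H} {I' : ModelWithCorners ℝ E' H'} {I'' : ModelWithCorners ℝ E'' H''}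
    {M M' M'' : Type*} [TopologicalSpace M] [TopologicalSpace M'] [TopologicalSpace M'']
    [ChartedSpace H M] [ChartedSpace H' M'] [ChartedSpace H'' M''] {f : M → M'} {g : M' → M''}
    {x : M} {y : M'} {A : E' →L[ℝ] E''} {B : E →L[ℝ] E'} (hg : HasMFDerivAt I' I'' g y A)
    (hf : HasMFDerivAt I I' f x B) (hy : f x = y) :
    HasMFDerivAt I I'' (fun z => g (f z)) x (A ∘L B : E →L[ℝ] E'') := by
  subst hy
  exact HasMFDerivAt.comp x hg hf

section Chart

variable {E : Type*} [NormedAddCommGroup E] [NormedSpace ℝ E]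
  {H : Type*} [TopologicalSpace H] (I : ModelWithCorners ℝ E H)
  (G : Type*) [TopologicalSpace G] [ChartedSpace H G] [Group G]

/-- The inverse of the preferred chart at the identity, recentered to map `0` to the identity. -/
def locExp (x : E) : G := (extChartAt I (1 : G)).symm (extChartAt I (1 : G) 1 + x)

/-- The preferred chart at the identity, recentered to map the identity to `0`. -/
def locLog (h : G) : E := extChartAt I (1 : G) h - extChartAt I (1 : G) 1

/-- The domain of `locExp`. -/
def locTarget : Set E := {x | extChartAt I (1 : G) 1 + x ∈ (extChartAt I (1 : G)).target}

/-- The domain of `locLog`. -/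
def locSource : Set G := (extChartAt I (1 : G)).source

theorem isOpen_locTarget [I.Boundaryless] : IsOpen (locTarget I G) :=
  (isOpen_extChartAt_target (I := I) (1 : G)).preimage (by fun_prop)

theorem isOpen_locSource : IsOpen (locSource I G) := isOpen_extChartAt_source (1 : G)

theorem zero_mem_locTarget : (0 : E) ∈ locTarget I G := by simp [locTarget]

theorem one_mem_locSource : (1 : G) ∈ locSource I G := by simp [locSource]

theorem locExp_zero : locExp I G 0 = 1 := by simp [locExp]

theorem locLog_one : locLog I G 1 = 0 := by simp [locLog]

variable {I G}

theorem locLog_locExp {x : E} (hx : x ∈ locTarget I G) : locLog I G (locExp I G x) = x := by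
  rw [locLog, locExp, (extChartAt I (1 : G)).right_inv hx, add_sub_cancel_left]

theorem locExp_locLog {h : G} (hh : h ∈ locSource I G) : locExp I G (locLog I G h) = h := by
  rw [locLog, locExp, add_sub_cancel, (extChartAt I (1 : G)).left_inv hh]

theorem locExp_mem {x : E} (hx : x ∈ locTarget I G) : locExp I G x ∈ locSource I G :=
  (extChartAt I (1 : G)).map_target hx

theorem locLog_mem {h : G} (hh : h ∈ locSource I G) : locLog I G h ∈ locTarget I G := by
  rw [locTarget, mem_ofPred_eq, locLog, add_sub_cancel]
  exact (extChartAt I (1 : G)).map_source hh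

variable [LieGroup I ∞ G]

theorem contMDiffOn_locExp : ContMDiffOn 𝓘(ℝ, E) I ∞ (locExp I G) (locTarget I G) :=
  (contMDiffOn_extChartAt_symm (I := I) (n := ∞) (1 : G)).comp
    (contDiff_const.add contDiff_id).contMDiff.contMDiffOn fun _ hx => hx

theorem contMDiffOn_locLog : ContMDiffOn I 𝓘(ℝ, E) ∞ (locLog I G) (locSource I G) := by
  have h : ContMDiffOn I 𝓘(ℝ, E) ∞ (extChartAt I (1 : G)) (locSource I G) := by
    rw [locSource, extChartAt_source]; exact contMDiffOn_extChartAt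
  exact h.sub contMDiffOn_const

variable (I) in
/-- The derivative of `locLog` at `h`. -/
def dlog (h : G) : E →L[ℝ] E := mfderiv I 𝓘(ℝ, E) (locLog I G) h

variable (I G) in
/-- The derivative of `locExp` at `x`. -/
def dexp (x : E) : E →L[ℝ] E := mfderiv 𝓘(ℝ, E) I (locExp I G) x

theorem hasMFDerivAt_locLog {h : G} (hh : h ∈ locSource I G) :
    HasMFDerivAt I 𝓘(ℝ, E) (locLog I G) h (dlog I h : E →L[ℝ] E) :=
  ((contMDiffOn_locLog.contMDiffAt ((isOpen_locSource I G).mem_nhds hh)).mdifferentiableAt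
    (by simp)).hasMFDerivAt

variable [I.Boundaryless]

theorem hasMFDerivAt_locExp {x : E} (hx : x ∈ locTarget I G) :
    HasMFDerivAt 𝓘(ℝ, E) I (locExp I G) x (dexp I G x : E →L[ℝ] E) :=
  ((contMDiffOn_locExp.contMDiffAt ((isOpen_locTarget I G).mem_nhds hx)).mdifferentiableAt
    (by simp)).hasMFDerivAt

theorem dexp_dlog {x : E} (hx : x ∈ locTarget I G) (v : E) :
    dexp I G x (dlog I (locExp I G x) v) = v := by
  have h1 : HasMFDerivAt 𝓘(ℝ, E) I (locExp I G) (locLog I G (locExp I G x))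
      (dexp I G x : E →L[ℝ] E) := by
    rw [locLog_locExp hx]; exact hasMFDerivAt_locExp hx
  have h := HasMFDerivAt.comp (locExp I G x) h1 (hasMFDerivAt_locLog (locExp_mem hx))
  have h' : HasMFDerivAt I I (locExp I G ∘ locLog I G) (locExp I G x)
      (ContinuousLinearMap.id ℝ E) :=
    (hasMFDerivAt_id _).congr_of_eventuallyEq
      (eventually_of_mem ((isOpen_locSource I G).mem_nhds (locExp_mem hx))
        fun y hy => locExp_locLog hy)
  exact DFunLike.congr_fun (hasMFDerivAt_unique h h') v

variable (I G)

omit [I.Boundaryless] in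
theorem dlog_one (v : E) : dlog I (1 : G) v = v := by
  have : IsManifold I 1 G := .of_le (n := ∞) (by simp)
  have h1 : HasMFDerivAt I 𝓘(ℝ, E) (extChartAt I (1 : G)) 1 (ContinuousLinearMap.id ℝ E) := by
    have := (mdifferentiableAt_extChartAt (I := I) (mem_chart_source H (1 : G))).hasMFDerivAt
    rw [mfderiv_extChartAt_self] at this
    exact this
  have h2 : HasFDerivAt (fun y : E => y - extChartAt I (1 : G) 1) (ContinuousLinearMap.id ℝ E)
      (extChartAt I (1 : G) 1) := (hasFDerivAt_id _).sub_const _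
  have h := HasMFDerivAt.comp (1 : G) h2.hasMFDerivAt h1
  exact DFunLike.congr_fun
    (hasMFDerivAt_unique (hasMFDerivAt_locLog (one_mem_locSource I G)) h) v

theorem dexp_zero (v : E) : dexp I G 0 v = v := by
  have := dexp_dlog (zero_mem_locTarget I G) v
  rwa [locExp_zero, dlog_one] at this

/-- The multiplication of `G` in the recentered chart at the identity. -/
def locMul (p : E × E) : E := locLog I G (locExp I G p.1 * locExp I G p.2)

/-- The left-invariant vector fields in the chart: the derivative of the multiplication in its
second variable. -/
def leftFrame (x : E) : E →L[ℝ] E := fderiv ℝ (fun y => locMul I G (x, y)) 0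

/-- The right-invariant vector fields in the chart: the derivative of the multiplication in its
first variable. -/
def rightFrame (x : E) : E →L[ℝ] E := fderiv ℝ (fun y => locMul I G (y, x)) 0

variable {I G}

theorem contDiffAt_locMul {x y : E} (hx : x ∈ locTarget I G) (hy : y ∈ locTarget I G)
    (hxy : locExp I G x * locExp I G y ∈ locSource I G) : ContDiffAt ℝ ∞ (locMul I G) (x, y) := by
  rw [← contMDiffAt_iff_contDiffAt]
  have h1 : ContMDiffAt 𝓘(ℝ, E × E) I ∞ (fun p : E × E => locExp I G p.1) (x, y) :=
    ContMDiffAt.comp (g := locExp I G) (f := Prod.fst) (x, y)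
      (contMDiffOn_locExp.contMDiffAt ((isOpen_locTarget I G).mem_nhds hx)) contDiff_fst.contMDiff.contMDiffAt
  have h2 : ContMDiffAt 𝓘(ℝ, E × E) I ∞ (fun p : E × E => locExp I G p.2) (x, y) :=
    ContMDiffAt.comp (g := locExp I G) (f := Prod.snd) (x, y)
      (contMDiffOn_locExp.contMDiffAt ((isOpen_locTarget I G).mem_nhds hy)) contDiff_snd.contMDiff.contMDiffAt
  exact ContMDiffAt.comp (x, y)
    (contMDiffOn_locLog.contMDiffAt ((isOpen_locSource I G).mem_nhds hxy)) (h1.mul h2)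

theorem contDiffAt_locMul_left {x : E} (hx : x ∈ locTarget I G) :
    ContDiffAt ℝ ∞ (locMul I G) (x, 0) :=
  contDiffAt_locMul hx (zero_mem_locTarget I G) (by rw [locExp_zero, mul_one]; exact locExp_mem hx)

theorem contDiffAt_locMul_right {x : E} (hx : x ∈ locTarget I G) :
    ContDiffAt ℝ ∞ (locMul I G) (0, x) :=
  contDiffAt_locMul (zero_mem_locTarget I G) hx (by rw [locExp_zero, one_mul]; exact locExp_mem hx)

theorem leftFrame_eq {x : E} (hx : x ∈ locTarget I G) :
    leftFrame I G x = fderiv ℝ (locMul I G) (x, 0) ∘L ContinuousLinearMap.inr ℝ E E := by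
  have h := ((contDiffAt_locMul_left hx).differentiableAt (by simp)).hasFDerivAt
  exact (HasFDerivAt.comp (g := locMul I G) (f := fun y => (x, y)) (0 : E) h
    (hasFDerivAt_prodMk_right x (0 : E))).fderiv

theorem rightFrame_eq {x : E} (hx : x ∈ locTarget I G) :
    rightFrame I G x = fderiv ℝ (locMul I G) (0, x) ∘L ContinuousLinearMap.inl ℝ E E := by
  have h := ((contDiffAt_locMul_right hx).differentiableAt (by simp)).hasFDerivAt
  exact (HasFDerivAt.comp (g := locMul I G) (f := fun y => (y, x)) (0 : E) h
    (hasFDerivAt_prodMk_left (0 : E) x)).fderiv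

theorem contDiffOn_leftFrame : ContDiffOn ℝ ∞ (leftFrame I G) (locTarget I G) := by
  intro x hx
  refine ContDiffWithinAt.congr (f := fun x => fderiv ℝ (locMul I G) (x, 0)
    ∘L ContinuousLinearMap.inr ℝ E E) ?_ (fun y hy => leftFrame_eq hy) (leftFrame_eq hx)
  have h := (contDiffAt_locMul_left hx).fderiv_right (m := ∞) (by simp)
  exact ((h.comp x (contDiffAt_id.prodMk contDiffAt_const)).clm_comp
    contDiffAt_const).contDiffWithinAt

theorem contDiffOn_rightFrame : ContDiffOn ℝ ∞ (rightFrame I G) (locTarget I G) := by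
  intro x hx
  refine ContDiffWithinAt.congr (f := fun x => fderiv ℝ (locMul I G) (0, x)
    ∘L ContinuousLinearMap.inl ℝ E E) ?_ (fun y hy => rightFrame_eq hy) (rightFrame_eq hx)
  have h := (contDiffAt_locMul_right hx).fderiv_right (m := ∞) (by simp)
  exact ((h.comp x (contDiffAt_const.prodMk contDiffAt_id)).clm_comp
    contDiffAt_const).contDiffWithinAt

theorem leftFrame_apply {x : E} (hx : x ∈ locTarget I G) (v : E) :
    leftFrame I G x v = dlog I (locExp I G x) (leftTrans I (locExp I G x) 1 v) := by
  have h1 := hasMFDerivAt_comp_of_model (hasMFDerivAt_leftTrans I (locExp I G x) 1)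
    (hasMFDerivAt_locExp (zero_mem_locTarget I G)) (locExp_zero I G)
  have h := hasMFDerivAt_comp_of_model (hasMFDerivAt_locLog (locExp_mem hx)) h1
    (by simp [locExp_zero])
  have h' : HasFDerivAt (fun y => locMul I G (x, y))
      (dlog I (locExp I G x) ∘L leftTrans I (locExp I G x) 1 ∘L dexp I G 0) 0 :=
    hasMFDerivAt_iff_hasFDerivAt.1 h
  have e : leftFrame I G x
      = dlog I (locExp I G x) ∘L leftTrans I (locExp I G x) 1 ∘L dexp I G 0 := h'.fderiv
  simp [e, dexp_zero]

theorem rightFrame_apply {x : E} (hx : x ∈ locTarget I G) (v : E) :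
    rightFrame I G x v = dlog I (locExp I G x) (rightTrans I (locExp I G x) 1 v) := by
  have h1 := hasMFDerivAt_comp_of_model (hasMFDerivAt_rightTrans I (locExp I G x) 1)
    (hasMFDerivAt_locExp (zero_mem_locTarget I G)) (locExp_zero I G)
  have h := hasMFDerivAt_comp_of_model (hasMFDerivAt_locLog (locExp_mem hx)) h1
    (by simp [locExp_zero])
  have h' : HasFDerivAt (fun y => locMul I G (y, x))
      (dlog I (locExp I G x) ∘L rightTrans I (locExp I G x) 1 ∘L dexp I G 0) 0 :=
    hasMFDerivAt_iff_hasFDerivAt.1 h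
  have e : rightFrame I G x
      = dlog I (locExp I G x) ∘L rightTrans I (locExp I G x) 1 ∘L dexp I G 0 := h'.fderiv
  simp [e, dexp_zero]

variable (I G) in
theorem leftFrame_zero (v : E) : leftFrame I G 0 v = v := by
  rw [leftFrame_apply (zero_mem_locTarget I G), locExp_zero, dlog_one, leftTrans_one]

variable (I G) in
theorem rightFrame_zero (v : E) : rightFrame I G 0 v = v := by
  have h := hasMFDerivAt_rightTrans I (1 : G) 1
  have e : (fun k : G => k * (1 : G)) = id := by ext k; simp
  rw [e] at h
  have e' := DFunLike.congr_fun (hasMFDerivAt_unique h (hasMFDerivAt_id 1)) v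
  rw [rightFrame_apply (zero_mem_locTarget I G), locExp_zero, dlog_one]
  exact e'

theorem contDiffAt_locMul_zero : ContDiffAt ℝ ∞ (locMul I G) 0 :=
  contDiffAt_locMul_left (zero_mem_locTarget I G)

theorem fderiv_leftFrame_zero (v w : E) : fderiv ℝ (leftFrame I G) 0 v w
    = fderiv ℝ (fderiv ℝ (locMul I G)) 0 (v, 0) (0, w) := by
  have h : DifferentiableAt ℝ (fderiv ℝ (locMul I G)) ((0 : E), (0 : E)) :=
    ((contDiffAt_locMul_zero (I := I) (G := G)).fderiv_right (m := ∞) (by simp)).differentiableAt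
      (by simp)
  have h1 := (HasFDerivAt.comp (f := fun y : E => (y, (0 : E))) (0 : E) h.hasFDerivAt
    (hasFDerivAt_prodMk_left (0 : E) (0 : E))).clm_comp
    (hasFDerivAt_const (ContinuousLinearMap.inr ℝ E E) (0 : E))
  have e : leftFrame I G =ᶠ[𝓝 0] fun x => fderiv ℝ (locMul I G) (x, 0)
      ∘L ContinuousLinearMap.inr ℝ E E :=
    eventually_of_mem ((isOpen_locTarget I G).mem_nhds (zero_mem_locTarget I G))
      fun y hy => leftFrame_eq hy
  rw [e.fderiv_eq]
  have := h1.fderiv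
  simp only [comp_def] at this
  rw [this]
  simp
  rfl

theorem fderiv_rightFrame_zero (v w : E) : fderiv ℝ (rightFrame I G) 0 v w
    = fderiv ℝ (fderiv ℝ (locMul I G)) 0 (0, v) (w, 0) := by
  have h : DifferentiableAt ℝ (fderiv ℝ (locMul I G)) ((0 : E), (0 : E)) :=
    ((contDiffAt_locMul_zero (I := I) (G := G)).fderiv_right (m := ∞) (by simp)).differentiableAt
      (by simp)
  have h1 := (HasFDerivAt.comp (f := fun y : E => ((0 : E), y)) (0 : E) h.hasFDerivAt
    (hasFDerivAt_prodMk_right (0 : E) (0 : E))).clm_comp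
    (hasFDerivAt_const (ContinuousLinearMap.inl ℝ E E) (0 : E))
  have e : rightFrame I G =ᶠ[𝓝 0] fun x => fderiv ℝ (locMul I G) (0, x)
      ∘L ContinuousLinearMap.inl ℝ E E :=
    eventually_of_mem ((isOpen_locTarget I G).mem_nhds (zero_mem_locTarget I G))
      fun y hy => rightFrame_eq hy
  rw [e.fderiv_eq]
  have := h1.fderiv
  simp only [comp_def] at this
  rw [this]
  simp
  rfl

/-- The Lie bracket measures the failure of left- and right-invariant fields to agree to first
order at the identity. -/
theorem fderiv_leftFrame_sub_fderiv_rightFrame (v w : E) :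
    fderiv ℝ (leftFrame I G) 0 v w - fderiv ℝ (rightFrame I G) 0 v w
      = fderiv ℝ (leftFrame I G) 0 v w - fderiv ℝ (leftFrame I G) 0 w v := by
  rw [fderiv_rightFrame_zero, fderiv_leftFrame_zero w v]
  congr 1
  exact ((contDiffAt_locMul_zero (I := I) (G := G)).isSymmSndFDerivAt
    (by rw [minSmoothness_of_isRCLikeNormedField]; exact WithTop.coe_le_coe.2 (le_top : (2 : ℕ∞) ≤ ⊤))).eq _ _

omit [I.Boundaryless] in
theorem dlog_eq_mfderiv {h : G} (hh : h ∈ locSource I G) :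
    dlog I h = (mfderiv I 𝓘(ℝ, E) (extChartAt I (1 : G)) h : E →L[ℝ] E) := by
  have : IsManifold I 1 G := .of_le (n := ∞) (by simp)
  rw [locSource, extChartAt_source] at hh
  have h1 := (mdifferentiableAt_extChartAt (I := I) hh).hasMFDerivAt
  have h2 : HasFDerivAt (fun y : E => y - extChartAt I (1 : G) 1) (ContinuousLinearMap.id ℝ E)
      (extChartAt I (1 : G) h) := (hasFDerivAt_id _).sub_const _
  exact (HasMFDerivAt.comp h h2.hasMFDerivAt h1).mfderiv

theorem mpullbackWithin_mulInvariantVectorField {y : E} (hy : y ∈ (extChartAt I (1 : G)).target)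
    (v : GroupLieAlgebra I G) :
    VectorField.mpullbackWithin 𝓘(ℝ, E) I (extChartAt I (1 : G)).symm
      (mulInvariantVectorField v) (range I) y
      = (leftFrame I G (y - extChartAt I (1 : G) 1) (v : E) : E) := by
  have : IsManifold I 1 G := .of_le (n := ∞) (by simp)
  have hx : y - extChartAt I (1 : G) 1 ∈ locTarget I G := by simpa [locTarget] using hy
  have e : locExp I G (y - extChartAt I (1 : G) 1) = (extChartAt I (1 : G)).symm y := by
    simp [locExp]
  have key : ∀ u : E, leftFrame I G (y - extChartAt I (1 : G) 1) u
      = (mfderiv I 𝓘(ℝ, E) (extChartAt I (1 : G)) ((extChartAt I (1 : G)).symm y) : E →L[ℝ] E)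
        (leftTrans I ((extChartAt I (1 : G)).symm y) 1 u) := fun u => by
    rw [leftFrame_apply hx, dlog_eq_mfderiv (locExp_mem hx), e]
    rfl
  rw [VectorField.mpullbackWithin_apply,
    ContinuousLinearMap.inverse_eq (mfderivWithin_extChartAt_symm_comp_mfderiv_extChartAt hy)
      (mfderiv_extChartAt_comp_mfderivWithin_extChartAt_symm hy)]
  exact (key v).symm

theorem bracket_eq_fderiv_leftFrame (v w : GroupLieAlgebra I G) :
    ⁅v, w⁆ = (fderiv ℝ (leftFrame I G) 0 (v : E) (w : E)
      - fderiv ℝ (leftFrame I G) 0 (w : E) (v : E) : E) := by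
  have : IsManifold I 1 G := .of_le (n := ∞) (by simp)
  have hev : ∀ u : GroupLieAlgebra I G, (VectorField.mpullbackWithin 𝓘(ℝ, E) I
      (extChartAt I (1 : G)).symm (mulInvariantVectorField u) (range I) : E → E)
      =ᶠ[𝓝 (extChartAt I (1 : G) 1)]
        fun y => leftFrame I G (y - extChartAt I (1 : G) 1) (u : E) := fun u =>
    eventually_of_mem ((isOpen_extChartAt_target (I := I) (1 : G)).mem_nhds
      (mem_extChartAt_target (1 : G))) fun y hy => mpullbackWithin_mulInvariantVectorField hy u
  have hd : DifferentiableAt ℝ (leftFrame I G) 0 :=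
    (contDiffOn_leftFrame.contDiffAt ((isOpen_locTarget I G).mem_nhds
      (zero_mem_locTarget I G))).differentiableAt (by simp)
  have hfd : ∀ u z : E, fderiv ℝ (fun y => leftFrame I G (y - extChartAt I (1 : G) 1) u)
      (extChartAt I (1 : G) 1) z = fderiv ℝ (leftFrame I G) 0 z u := fun u z => by
    have h0 : HasFDerivAt (leftFrame I G) (fderiv ℝ (leftFrame I G) 0)
        (extChartAt I (1 : G) 1 - extChartAt I (1 : G) 1) := by
      rw [sub_self]; exact hd.hasFDerivAt
    have h1 := (HasFDerivAt.comp (g := leftFrame I G)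
      (f := fun y : E => y - extChartAt I (1 : G) 1) (extChartAt I (1 : G) 1) h0
      ((hasFDerivAt_id _).sub_const _)).clm_apply (hasFDerivAt_const u _)
    have h2 := h1.fderiv
    simp only [comp_def] at h2
    rw [h2]
    simp
  have key : ∀ (u z : E) (U Z : E → E),
      U =ᶠ[𝓝 (extChartAt I (1 : G) 1)] (fun y => leftFrame I G (y - extChartAt I (1 : G) 1) u) →
      Z =ᶠ[𝓝 (extChartAt I (1 : G) 1)] (fun y => leftFrame I G (y - extChartAt I (1 : G) 1) z) →
      VectorField.lieBracketWithin ℝ U Z ((extChartAt I (1 : G)).symm ⁻¹' univ ∩ range I)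
        (extChartAt I (1 : G) 1)
        = fderiv ℝ (leftFrame I G) 0 u z - fderiv ℝ (leftFrame I G) 0 z u := by
    intro u z U Z hU hZ
    rw [preimage_univ, univ_inter, ModelWithCorners.range_eq_univ,
      VectorField.lieBracketWithin_univ, hU.lieBracket_vectorField_eq hZ]
    simp only [VectorField.lieBracket, hfd, sub_self, leftFrame_zero]
  have hid : ∀ u : E, ((mfderiv I 𝓘(ℝ, E) (extChartAt I (1 : G)) 1).inverse : E →L[ℝ] E) u = u := by
    intro u
    rw [mfderiv_extChartAt_self]
    exact DFunLike.congr_fun (ContinuousLinearMap.inverse_id (R := ℝ) (M := E)) u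
  rw [GroupLieAlgebra.bracket_def, ← VectorField.mlieBracketWithin_univ,
    VectorField.mlieBracketWithin_apply]
  exact (hid _).trans (key _ _ _ _ (hev v) (hev w))

end Chart

section Families

variable {E : Type*} [NormedAddCommGroup E] [NormedSpace ℝ E]
  {V : Type*} [NormedAddCommGroup V] [NormedSpace ℝ V]
  {E' : Type*} [NormedAddCommGroup E'] [NormedSpace ℝ E']
  {H' : Type*} [TopologicalSpace H'] {J : ModelWithCorners ℝ E' H'}
  {N : Type*} [TopologicalSpace N] [ChartedSpace H' N]

theorem hasFDerivAt_of_contMDiffOn {Φ : N → E → V} {S : Set N} {U : Set E} (hU : IsOpen U)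
    (hΦ : ContMDiffOn (J.prod 𝓘(ℝ, E)) 𝓘(ℝ, V) 1 (fun p : N × E => Φ p.1 p.2) (S ×ˢ U))
    {p : N} (hp : p ∈ S) {x : E} (hx : x ∈ U) : HasFDerivAt (Φ p) (fderiv ℝ (Φ p) x) x := by
  have h : ContMDiffOn 𝓘(ℝ, E) 𝓘(ℝ, V) 1 (Φ p) U :=
    hΦ.comp (contMDiffOn_const.prodMk contMDiffOn_id) fun y hy => ⟨hp, hy⟩
  exact (((contMDiffOn_iff_contDiffOn.1 h).contDiffAt (hU.mem_nhds hx)).differentiableAt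
    (by simp)).hasFDerivAt

theorem continuousOn_fderiv_of_contMDiffOn [IsManifold J 1 N] {Φ : N → E → V} {S : Set N} {U : Set E} (hU : IsOpen U)
    (hΦ : ContMDiffOn (J.prod 𝓘(ℝ, E)) 𝓘(ℝ, V) 1 (fun p : N × E => Φ p.1 p.2) (S ×ˢ U)) :
    ContinuousOn (fun p : N × E => fderiv ℝ (Φ p.1) p.2) (S ×ˢ U) := by
  intro q hq
  have hf : ContMDiffWithinAt ((J.prod 𝓘(ℝ, E)).prod 𝓘(ℝ, E)) 𝓘(ℝ, V) 1
      (uncurry fun (q : N × E) (y : E) => Φ q.1 y) ((S ×ˢ U) ×ˢ U) (q, q.2) := by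
    have hc : ContMDiffOn ((J.prod 𝓘(ℝ, E)).prod 𝓘(ℝ, E)) 𝓘(ℝ, V) 1
        (fun z : (N × E) × E => Φ z.1.1 z.2) ((S ×ˢ U) ×ˢ U) :=
      hΦ.comp (f := fun z : (N × E) × E => (z.1.1, z.2))
        ((contMDiff_fst.comp contMDiff_fst).prodMk contMDiff_snd).contMDiffOn
        fun z hz => ⟨hz.1.1, hz.2⟩
    exact hc _ ⟨hq, hq.2⟩
  have h := hf.mfderivWithin (g := Prod.snd) (m := 0) contMDiffWithinAt_snd hq
    (fun z hz => hz.2) (by simp) hU.uniqueMDiffOn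
  have h' := h.continuousWithinAt
  have e : ∀ z ∈ S ×ˢ U, fderiv ℝ (Φ z.1) z.2
      = inTangentCoordinates 𝓘(ℝ, E) 𝓘(ℝ, V) Prod.snd (fun z : N × E => Φ z.1 z.2)
        (fun z => mfderivWithin 𝓘(ℝ, E) 𝓘(ℝ, V) (fun y => Φ z.1 y) U z.2) q z := fun z hz => by
    refine Eq.trans ?_ (congrFun (inTangentCoordinates_model_space (I := 𝓘(ℝ, E)) (I' := 𝓘(ℝ, V))
      Prod.snd (fun z : N × E => Φ z.1 z.2)
        (fun z => mfderivWithin 𝓘(ℝ, E) 𝓘(ℝ, V) (fun y => Φ z.1 y) U z.2) q) z).symm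
    rw [mfderivWithin_eq_fderivWithin, fderivWithin_of_isOpen hU hz.2]
  exact ContinuousWithinAt.congr h' e (e q hq)

theorem UniformC1.of_contMDiffOn [ProperSpace E] [IsManifold J 1 N] {Φ : N → E → V} {S : Set N} {U : Set E}
    (hU : IsOpen U)
    (hΦ : ContMDiffOn (J.prod 𝓘(ℝ, E)) 𝓘(ℝ, V) 1 (fun p : N × E => Φ p.1 p.2) (S ×ˢ U))
    {a b r R : ℝ} (hr : 0 < r) (hrR : r < R) (hRU : ball 0 R ⊆ U) {c : ℝ → N}
    (hc : ContinuousOn c (Icc a b)) (hcS : MapsTo c (Icc a b) S) :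
    UniformC1 a b r (fun t => Φ (c t)) (fun t => fderiv ℝ (Φ (c t)) 0) := by
  have hm : MapsTo (fun z : ℝ × E => (c z.1, z.2)) (Icc a b ×ˢ ball 0 R) (S ×ˢ U) :=
    fun z hz => ⟨hcS hz.1, hRU hz.2⟩
  have hcc : ContinuousOn (fun z : ℝ × E => (c z.1, z.2)) (Icc a b ×ˢ ball 0 R) :=
    (hc.comp continuousOn_fst fun z hz => hz.1).prodMk continuousOn_snd
  exact UniformC1.of_hasFDerivAt (Φ' := fun t x => fderiv ℝ (Φ (c t)) x) hr hrR
    (hΦ.continuousOn.comp hcc hm) ((continuousOn_fderiv_of_contMDiffOn hU hΦ).comp hcc hm)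
    fun t ht x hx => hasFDerivAt_of_contMDiffOn hU hΦ (hcS ht) (hRU hx)

end Families

section Dynamics

variable {E : Type*} [NormedAddCommGroup E] [NormedSpace ℝ E]
  {H : Type*} [TopologicalSpace H] {I : ModelWithCorners ℝ E H} [I.Boundaryless]
  {G : Type*} [TopologicalSpace G] [ChartedSpace H G] [Group G] [LieGroup I ∞ G]

theorem hasDerivAt_locLog_inv_mul {g γ : ℝ → G} {ξ ζ : E} {t : ℝ}
    (hg : HasVelocityAt I g (leftTrans I (g t) 1 ξ) t)
    (hγ : HasVelocityAt I γ (leftTrans I (γ t) 1 ζ) t) (hmem : (g t)⁻¹ * γ t ∈ locSource I G) :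
    HasDerivAt (fun s => locLog I G ((g s)⁻¹ * γ s))
      (leftFrame I G (locLog I G ((g t)⁻¹ * γ t)) ζ
        - rightFrame I G (locLog I G ((g t)⁻¹ * γ t)) ξ) t := by
  obtain ⟨u, hu⟩ := hg.exists_inv_mul hγ
  have hv := hg.mul hu
  simp only [mul_inv_cancel_left] at hv
  set h := (g t)⁻¹ * γ t with hh
  have hgh : γ t = g t * h := by rw [hh, mul_inv_cancel_left]
  have e := hv.unique hγ
  have e1 := rightTrans_leftTrans I (g t) h 1 ξ
  have e2 := leftTrans_comp I (g t) h 1 ζ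
  rw [mul_one, one_mul] at e1
  rw [mul_one] at e2
  rw [hgh, ← e2, e1, ← map_add] at e
  have e3 := leftTrans_injective I _ _ e
  have hd := hasVelocityAt_iff_hasDerivAt.1 (hu.comp (hasMFDerivAt_locLog hmem))
  rw [leftFrame_apply (locLog_mem hmem), rightFrame_apply (locLog_mem hmem), locExp_locLog hmem,
    ← map_sub, ← e3, add_sub_cancel_left]
  exact hd

theorem hasVelocityAt_mul_locExp {g : ℝ → G} {x : ℝ → E} {ξ ζ : E} {t : ℝ}
    (hg : HasVelocityAt I g (leftTrans I (g t) 1 ξ) t) (hmem : x t ∈ locTarget I G)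
    (hx : HasDerivAt x (leftFrame I G (x t) ζ - rightFrame I G (x t) ξ) t) :
    HasVelocityAt I (fun s => g s * locExp I G (x s))
      (leftTrans I (g t * locExp I G (x t)) 1 ζ) t := by
  have hh : HasVelocityAt I (fun s => locExp I G (x s)) _ t :=
    (hasVelocityAt_iff_hasDerivAt.2 hx).comp (hasMFDerivAt_locExp hmem)
  have hv := hg.mul hh
  set h := locExp I G (x t) with hhdef
  have e1 := rightTrans_leftTrans I (g t) h 1 ξ
  have e2 := leftTrans_comp I (g t) h 1 ζ
  rw [mul_one, one_mul] at e1
  rw [mul_one] at e2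
  rw [leftFrame_apply hmem, rightFrame_apply hmem, ← map_sub, dexp_dlog hmem, e1, ← map_add,
    ← hhdef, add_sub_cancel, e2] at hv
  exact hv

omit [LieGroup I ∞ G] [Group G] [I.Boundaryless] in
variable (I) in
theorem hasVelocityAt_const (a : G) (t : ℝ) : HasVelocityAt I (fun _ => a) 0 t := by
  have e : ((1 : ℝ →L[ℝ] ℝ).smulRight (0 : E)) = 0 := by ext; simp
  rw [HasVelocityAt, e]
  exact hasMFDerivAt_const a t

/-- A curve which is continuous at `t` and an integral curve of a continuous left-trivialized field
near `t` except at `t` is also an integral curve at `t`. -/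
theorem hasVelocityAt_of_eventually_ne {γ : ℝ → G} {ζ : ℝ → E} {t : ℝ} (hγ : ContinuousAt γ t)
    (hζ : ContinuousAt ζ t)
    (h : ∀ᶠ s in 𝓝[≠] t, HasVelocityAt I γ (leftTrans I (γ s) 1 (ζ s)) s) :
    HasVelocityAt I γ (leftTrans I (γ t) 1 (ζ t)) t := by
  have hconst : ∀ s : ℝ, HasVelocityAt I (fun _ : ℝ => γ t) (leftTrans I (γ t) 1 (0 : E)) s :=
    fun s => by rw [map_zero]; exact hasVelocityAt_const I (γ t) s
  set y : ℝ → E := fun s => locLog I G ((γ t)⁻¹ * γ s) with hy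
  have hhc : ContinuousAt (fun s => (γ t)⁻¹ * γ s) t := by
    have := topologicalGroup_of_lieGroup I ∞ (G := G)
    exact continuousAt_const.mul hγ
  have hyt : y t = 0 := by simp [hy, locLog_one]
  have hmem : ∀ᶠ s in 𝓝 t, (γ t)⁻¹ * γ s ∈ locSource I G := by
    refine hhc.eventually_mem ((isOpen_locSource I G).mem_nhds ?_)
    rw [inv_mul_cancel]; exact one_mem_locSource I G
  have hyc : ContinuousAt y t := by
    have h1 : ContinuousAt (locLog I G) ((γ t)⁻¹ * γ t) :=
      contMDiffOn_locLog.continuousOn.continuousAt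
        ((isOpen_locSource I G).mem_nhds hmem.self_of_nhds)
    exact ContinuousAt.comp (f := fun s => (γ t)⁻¹ * γ s) h1 hhc
  have hFc : ContinuousAt (fun s => leftFrame I G (y s) (ζ s)) t := by
    have h1 : ContinuousAt (leftFrame I G) (y t) :=
      contDiffOn_leftFrame.continuousOn.continuousAt ((isOpen_locTarget I G).mem_nhds
        (by rw [hyt]; exact zero_mem_locTarget I G))
    exact (ContinuousAt.comp (f := y) h1 hyc).clm_apply hζ
  have hd : HasDerivAt y (leftFrame I G (y t) (ζ t)) t := by
    refine hasDerivAt_of_eventually_hasDerivAt_of_ne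
      (g := fun s => leftFrame I G (y s) (ζ s)) ?_ hyc hFc
    filter_upwards [h, mem_nhdsWithin_of_mem_nhds hmem] with s hs hs'
    have := hasDerivAt_locLog_inv_mul (hconst s) hs hs'
    rwa [map_zero, sub_zero] at this
  have hv := hasVelocityAt_mul_locExp (g := fun _ => γ t) (x := y) (ξ := 0) (ζ := ζ t) (hconst t)
    (by rw [hyt]; exact zero_mem_locTarget I G) (by rwa [map_zero, sub_zero])
  have e : γ t * locExp I G (y t) = γ t := by rw [hyt, locExp_zero, mul_one]
  rw [e] at hv
  refine hv.congr_of_eventuallyEq ?_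
  filter_upwards [hmem] with s hs
  rw [hy, locExp_locLog hs, mul_inv_cancel_left]

variable (I) in
/-- The derivative of `F` at `a`, read in the preferred chart at `a`. -/
def coordDeriv {V : Type*} [NormedAddCommGroup V] [NormedSpace ℝ V] (F : G → V) (a : G) :
    E →L[ℝ] V := mfderiv I 𝓘(ℝ, V) F a

theorem hasFDerivAt_comp_mul_locExp {V : Type*} [NormedAddCommGroup V] [NormedSpace ℝ V]
    {F : G → V} {a : G} (hF : MDifferentiableAt I 𝓘(ℝ, V) F a) :
    HasFDerivAt (fun x => F (a * locExp I G x))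
      (coordDeriv I F a ∘L leftTrans I a 1) 0 := by
  have h1 := hasMFDerivAt_comp_of_model (hasMFDerivAt_leftTrans I a 1)
    (hasMFDerivAt_locExp (zero_mem_locTarget I G)) (locExp_zero I G)
  have hF' : HasMFDerivAt I 𝓘(ℝ, V) F a (coordDeriv I F a : E →L[ℝ] V) := hF.hasMFDerivAt
  have h2 := hasMFDerivAt_comp_of_model hF' h1 (by simp [locExp_zero])
  have h3 := hasMFDerivAt_iff_hasFDerivAt.1 h2
  have e : dexp I G 0 = ContinuousLinearMap.id ℝ E := by ext v; exact dexp_zero I G v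
  rw [e, ContinuousLinearMap.comp_id] at h3
  exact h3

/-- The linearization at the identity of the difference between the left-invariant field with value
`F` and the right-invariant field with value `F a`. -/
theorem fderiv_leftFrame_sub_rightFrame {F : G → GroupLieAlgebra I G} {a : G}
    (hF : MDifferentiableAt I 𝓘(ℝ, E) (M' := E) F a) (η : GroupLieAlgebra I G) :
    (fderiv ℝ (fun x => leftFrame I G x (F (a * locExp I G x))) 0
      - fderiv ℝ (fun x => rightFrame I G x (F a)) 0) (η : E)
      = (leftDerivLie (I := I) F a η - ⁅F a, η⁆ : GroupLieAlgebra I G) := by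
  obtain ⟨F', hF'⟩ : ∃ F' : G → E, F' = F := ⟨F, rfl⟩
  subst hF'
  have hA : DifferentiableAt ℝ (leftFrame I G) 0 :=
    (contDiffOn_leftFrame.contDiffAt ((isOpen_locTarget I G).mem_nhds
      (zero_mem_locTarget I G))).differentiableAt (by simp)
  have hB : DifferentiableAt ℝ (rightFrame I G) 0 :=
    (contDiffOn_rightFrame.contDiffAt ((isOpen_locTarget I G).mem_nhds
      (zero_mem_locTarget I G))).differentiableAt (by simp)
  have h1 := (hA.hasFDerivAt.clm_apply (hasFDerivAt_comp_mul_locExp (F := F') hF)).fderiv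
  have h2 := (hB.hasFDerivAt.clm_apply (hasFDerivAt_const (F' a) (0 : E))).fderiv
  have key : ∀ v : E, (fderiv ℝ (fun x => leftFrame I G x (F' (a * locExp I G x))) 0
      - fderiv ℝ (fun x => rightFrame I G x (F' a)) 0) v
      = (coordDeriv I F' a ∘L leftTrans I a 1) v
        - (fderiv ℝ (leftFrame I G) 0 (F' a) v - fderiv ℝ (leftFrame I G) 0 v (F' a)) := by
    intro v
    have h3 := fderiv_leftFrame_sub_fderiv_rightFrame (I := I) (G := G) v (F' a)
    rw [h1, h2]
    simp only [sub_apply, add_apply, ContinuousLinearMap.comp_apply,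
      ContinuousLinearMap.flip_apply, leftFrame_zero, locExp_zero, mul_one, zero_apply, map_zero,
      zero_add]
    rw [add_sub_assoc, h3]
    abel
  have hb := bracket_eq_fderiv_leftFrame (I := I) (G := G) (F' a) η
  rw [hb]
  exact key η

end Dynamics

section Trajectories

variable {E : Type*} [NormedAddCommGroup E] [NormedSpace ℝ E]
  {H : Type*} [TopologicalSpace H] {I : ModelWithCorners ℝ E H}
  {G : Type*} [TopologicalSpace G] [ChartedSpace H G] [Group G]
  {n : ℕ} {t₀ t₁ r : ℝ} {g₀ : G} {f : Fin (n + 1) → G → ℝ → GroupLieAlgebra I G}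
  {T T' : Fin n → ℝ} {g γ : ℝ → G}

/-- The `k`-th mode, with values in `E`. -/
def modeCoord (f : Fin (n + 1) → G → ℝ → GroupLieAlgebra I G) (k : Fin (n + 1)) (a : G) (t : ℝ) :
    E := f k a t

/-- The `k`-th mode as a left-invariant field, in the chart along `g`. -/
def leftMode (f : Fin (n + 1) → G → ℝ → GroupLieAlgebra I G) (g : ℝ → G) (k : Fin (n + 1)) (t : ℝ)
    (x : E) : E := leftFrame I G x (modeCoord f k (g t * locExp I G x) t)

/-- The value of the `k`-th mode along `g`, extended to a right-invariant field, in the chart. -/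
def rightMode (f : Fin (n + 1) → G → ℝ → GroupLieAlgebra I G) (g : ℝ → G) (k : Fin (n + 1)) (t : ℝ)
    (x : E) : E := rightFrame I G x (modeCoord f k (g t) t)

/-- The switched field, with values in `E`. -/
def switchedCoord (f : Fin (n + 1) → G → ℝ → GroupLieAlgebra I G) (t₀ t₁ : ℝ) (T : Fin n → ℝ)
    (a : G) (t : ℝ) : E := ∑ k, modeWeight t₀ t₁ T k t • modeCoord f k a t

theorem tubeField_modes (t : ℝ) (x : E) :
    tubeField t₀ t₁ (leftMode f g) (rightMode f g) T T' t x
      = leftFrame I G x (switchedCoord f t₀ t₁ T' (g t * locExp I G x) t)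
        - rightFrame I G x (switchedCoord f t₀ t₁ T (g t) t) := by
  simp only [tubeField, leftMode, rightMode, switchedCoord, map_sum, map_smul,
    Finset.sum_sub_distrib]

theorem isTrajectory_iff : IsTrajectory f t₀ t₁ g₀ T γ ↔ γ t₀ = g₀ ∧ ContinuousOn γ (Icc t₀ t₁) ∧
    ∀ t ∈ Icc t₀ t₁, t ∉ range (times t₀ t₁ T) →
      HasVelocityAt I γ (leftTrans I (γ t) 1 (switchedCoord f t₀ t₁ T (γ t) t)) t :=
  ⟨fun h => ⟨h.init, h.continuousOn, h.ode⟩, fun h => ⟨h.1, h.2.1, h.2.2⟩⟩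

theorem mem_Ioo_of_notMem_range_times {t : ℝ} (ht : t ∈ Icc t₀ t₁)
    (htT : t ∉ range (times t₀ t₁ T)) : t ∈ Ioo t₀ t₁ := by
  refine ⟨lt_of_le_of_ne ht.1 fun h => htT ⟨0, ?_⟩, lt_of_le_of_ne ht.2 fun h =>
    htT ⟨Fin.last (n + 1), ?_⟩⟩
  · rw [times_zero, h]
  · rw [times_last, h]

theorem continuousOn_mode (hf : ∀ k, ContMDiffOn (I.prod 𝓘(ℝ, ℝ)) 𝓘(ℝ, E) 1 (M' := E)
      (fun p : G × ℝ => (f k p.1 p.2 : E)) (univ ×ˢ Icc t₀ t₁)) (k : Fin (n + 1))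
    (hγ : ContinuousOn γ (Icc t₀ t₁)) : 
    ContinuousOn (fun s => modeCoord f k (γ s) s) (Icc t₀ t₁) :=
  (hf k).continuousOn.comp (f := fun s => (γ s, s)) (hγ.prodMk continuousOn_id)
    fun _ hs => ⟨mem_univ _, hs⟩

variable [LieGroup I ∞ G] [I.Boundaryless]

theorem isTrajectory_of_isTubeSolution [CompleteSpace E]
    (hf : ∀ k, ContMDiffOn (I.prod 𝓘(ℝ, ℝ)) 𝓘(ℝ, E) 1 (M' := E)
      (fun p : G × ℝ => (f k p.1 p.2 : E)) (univ ×ˢ Icc t₀ t₁))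
    (h01 : t₀ ≤ t₁) {DP DQ : Fin (n + 1) → ℝ → E →L[ℝ] E}
    (hsys : IsTubeSystem t₀ t₁ r (leftMode f g) (rightMode f g) DP DQ)
    (hr : closedBall 0 r ⊆ locTarget I G) (hg : IsTrajectory f t₀ t₁ g₀ T g) {x : ℝ → E}
    (hx : IsTubeSolution t₀ t₁ r (leftMode f g) (rightMode f g) T T' t₁ x) :
    IsTrajectory f t₀ t₁ g₀ T' (fun t => g t * locExp I G (x t)) := by
  obtain ⟨hg0, hgc, hgo⟩ := isTrajectory_iff.1 hg
  have := topologicalGroup_of_lieGroup I ∞ (G := G)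
  have hxU : ∀ t ∈ Icc t₀ t₁, x t ∈ locTarget I G := fun t ht =>
    hr (by simpa using hx.norm_le t ht)
  have hγc : ContinuousOn (fun t => g t * locExp I G (x t)) (Icc t₀ t₁) :=
    hgc.mul (contMDiffOn_locExp.continuousOn.comp hx.continuousOn hxU)
  refine isTrajectory_iff.2 ⟨?_, hγc, fun t ht htT => ?_⟩
  · have hx0 : x t₀ = 0 := by
      rw [hx.eq_integral t₀ (left_mem_Icc.2 h01), intervalIntegral.integral_same]
    simp only [hx0, locExp_zero, mul_one, hg0]
  · have ht' := mem_Ioo_of_notMem_range_times ht htT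
    have hmem : Icc t₀ t₁ ∈ 𝓝 t := Icc_mem_nhds ht'.1 ht'.2
    refine hasVelocityAt_of_eventually_ne (hγc.continuousAt hmem)
      (ζ := fun s => switchedCoord f t₀ t₁ T' (g s * locExp I G (x s)) s) ?_ ?_
    · refine tendsto_finsetSum _ fun k _ => ?_
      have hw : ContinuousAt (modeWeight t₀ t₁ T' k) t :=
        (continuousAt_const (y := modeWeight t₀ t₁ T' k t)).congr
          ((modeWeight_eventuallyEq htT k).mono fun _ hs => hs.symm)
      exact hw.smul ((continuousOn_mode hf k hγc).continuousAt hmem)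
    · have h1 : ∀ᶠ s in 𝓝[≠] t, s ∉ range (times t₀ t₁ T) := by
        have hfin : (range (times t₀ t₁ T) \ {t}).Finite := (finite_range _).sdiff
        filter_upwards [mem_nhdsWithin_of_mem_nhds (hfin.isClosed.isOpen_compl.mem_nhds
          fun h => h.2 rfl), self_mem_nhdsWithin] with s hs hst hsT
        exact hs ⟨hsT, hst⟩
      have h2 : ∀ᶠ s in 𝓝[≠] t, s ∉ range (times t₀ t₁ T') :=
        mem_nhdsWithin_of_mem_nhds ((finite_range _).isClosed.isOpen_compl.mem_nhds htT)
      filter_upwards [h1, h2, mem_nhdsWithin_of_mem_nhds (Ioo_mem_nhds ht'.1 ht'.2)]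
        with s hsT hsT' hs
      have hs' := Ioo_subset_Icc_self hs
      refine hasVelocityAt_mul_locExp (hgo s hs' hsT) (hxU s hs') ?_
      have hd := hsys.hasDerivAt hx hs hsT hsT'
      rwa [tubeField_modes] at hd

theorem isTubeSolution_of_isTrajectory [CompleteSpace E]
    {DP DQ : Fin (n + 1) → ℝ → E →L[ℝ] E}
    (hsys : IsTubeSystem t₀ t₁ r (leftMode f g) (rightMode f g) DP DQ)
    (hg : IsTrajectory f t₀ t₁ g₀ T g) (hγ : IsTrajectory f t₀ t₁ g₀ T' γ) {b : ℝ}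
    (hb : b ∈ Icc t₀ t₁) (hmem : ∀ t ∈ Icc t₀ b, (g t)⁻¹ * γ t ∈ locSource I G)
    (hnorm : ∀ t ∈ Icc t₀ b, ‖locLog I G ((g t)⁻¹ * γ t)‖ ≤ r) :
    IsTubeSolution t₀ t₁ r (leftMode f g) (rightMode f g) T T' b
      (fun t => locLog I G ((g t)⁻¹ * γ t)) := by
  obtain ⟨hg0, hgc, hgo⟩ := isTrajectory_iff.1 hg
  obtain ⟨hγ0, hγc, hγo⟩ := isTrajectory_iff.1 hγ
  have := topologicalGroup_of_lieGroup I ∞ (G := G)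
  have hsub : Icc t₀ b ⊆ Icc t₀ t₁ := Icc_subset_Icc_right hb.2
  have hxc : ContinuousOn (fun t => locLog I G ((g t)⁻¹ * γ t)) (Icc t₀ b) :=
    contMDiffOn_locLog.continuousOn.comp ((hgc.inv.mul hγc).mono hsub) hmem
  refine ⟨hxc, hnorm, fun t ht => ?_⟩
  have htb : Icc t₀ t ⊆ Icc t₀ b := Icc_subset_Icc_right ht.2
  have hint := hsys.intervalIntegrable T T' (hsub ht) (hxc.mono htb)
    fun s hs => hnorm s (htb hs)
  have hftc := integral_eq_of_hasDerivAt_off_countable_of_le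
    (fun t => locLog I G ((g t)⁻¹ * γ t)) _ ht.1
    (s := range (times t₀ t₁ T) ∪ range (times t₀ t₁ T'))
    ((countable_range _).union (countable_range _)) (hxc.mono htb) (fun s hs => ?_) hint
  · rw [hftc, hg0, hγ0, inv_mul_cancel, locLog_one, sub_zero]
  · have hs1 := Ioo_subset_Icc_self hs.1
    have hd := hasDerivAt_locLog_inv_mul
      (hgo s (hsub (htb hs1)) fun h => hs.2 (Or.inl h))
      (hγo s (hsub (htb hs1)) fun h => hs.2 (Or.inr h)) (hmem s (htb hs1))
    rwa [tubeField_modes, locExp_locLog (hmem s (htb hs1)), mul_inv_cancel_left]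

/-- Trajectories for transition times close to `T` do not leave the tube around `g`. -/
theorem forall_mem_tube [CompleteSpace E] [ProperSpace E] [T2Space G] (h01 : t₀ ≤ t₁)
    {DP DQ : Fin (n + 1) → ℝ → E →L[ℝ] E}
    (hsys : IsTubeSystem t₀ t₁ r (leftMode f g) (rightMode f g) DP DQ)
    (hr : closedBall 0 r ⊆ locTarget I G) (hg : IsTrajectory f t₀ t₁ g₀ T g) :
    ∃ η > 0, ∀ T', ‖T' - T‖ ≤ η → ∀ γ, IsTrajectory f t₀ t₁ g₀ T' γ → ∀ t ∈ Icc t₀ t₁,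
      (g t)⁻¹ * γ t ∈ locSource I G ∧ ‖locLog I G ((g t)⁻¹ * γ t)‖ ≤ r := by
  obtain ⟨C, hC, hbd⟩ := hsys.exists_norm_le h01
  obtain ⟨η, hη, hCη⟩ := exists_pos_mul_lt (half_pos hsys.pos) C
  refine ⟨η, hη, fun T' hT' γ hγ => ?_⟩
  obtain ⟨hg0, hgc, -⟩ := isTrajectory_iff.1 hg
  obtain ⟨hγ0, hγc, -⟩ := isTrajectory_iff.1 hγ
  have := topologicalGroup_of_lieGroup I ∞ (G := G)
  have hhc : ContinuousOn (fun t => (g t)⁻¹ * γ t) (Icc t₀ t₁) := hgc.inv.mul hγc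
  have hr2 : closedBall (0 : E) (r / 2) ⊆ locTarget I G :=
    (closedBall_subset_closedBall (half_le_self hsys.pos.le)).trans hr
  set K : Set G := locExp I G '' closedBall 0 (r / 2) with hK
  have hKc : IsClosed K :=
    ((isCompact_closedBall (0 : E) (r / 2)).image_of_continuousOn
      (contMDiffOn_locExp.continuousOn.mono hr2)).isClosed
  set W : Set G := locSource I G ∩ locLog I G ⁻¹' ball 0 r with hW
  have hWo : IsOpen W := contMDiffOn_locLog.continuousOn.isOpen_inter_preimage
    (isOpen_locSource I G) isOpen_ball
  have hKW : K ⊆ W := by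
    rintro _ ⟨x, hx, rfl⟩
    refine ⟨locExp_mem (hr2 hx), ?_⟩
    rw [mem_preimage, locLog_locExp (hr2 hx)]
    exact closedBall_subset_ball (half_lt_self hsys.pos) hx
  have key : Icc t₀ t₁ ⊆ {t | (g t)⁻¹ * γ t ∈ K} := by
    refine IsClosed.Icc_subset_of_forall_mem_nhdsGT_of_Icc_subset ?_ ?_ fun t ht htK => ?_
    · rw [inter_comm]
      exact hhc.preimage_isClosed_of_isClosed isClosed_Icc hKc
    · refine ⟨0, by simpa using (half_pos hsys.pos).le, ?_⟩
      rw [locExp_zero, hg0, hγ0, inv_mul_cancel]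
    · have hW1 : {s | (g s)⁻¹ * γ s ∈ W} ∈ 𝓝[Icc t₀ t₁] t :=
        hhc t ⟨ht.1, ht.2.le⟩ (hWo.mem_nhds (hKW (htK (right_mem_Icc.2 ht.1))))
      have hW2 : {s | (g s)⁻¹ * γ s ∈ W} ∈ 𝓝[≥] t := by
        rw [← nhdsWithin_Icc_eq_nhdsGE ht.2]
        exact nhdsWithin_mono t (Icc_subset_Icc_left ht.1) hW1
      obtain ⟨c, hc, hcW⟩ := (mem_nhdsGE_iff_exists_Ico_subset' ht.2).1 hW2
      filter_upwards [Ioo_mem_nhdsGT (lt_min hc ht.2)] with s hs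
      have hs1 : s < c := hs.2.trans_le (min_le_left _ _)
      have hst₁ : s ∈ Icc t₀ t₁ := ⟨ht.1.trans hs.1.le, hs.2.le.trans (min_le_right _ _)⟩
      have hall : ∀ σ ∈ Icc t₀ s, (g σ)⁻¹ * γ σ ∈ W := fun σ hσ => by
        rcases le_or_gt σ t with h | h
        · exact hKW (htK ⟨hσ.1, h⟩)
        · exact hcW ⟨h.le, hσ.2.trans_lt hs1⟩
      have hsol := isTubeSolution_of_isTrajectory hsys hg hγ hst₁ (fun σ hσ => (hall σ hσ).1)
        fun σ hσ => by simpa using (mem_ball.1 (hall σ hσ).2).le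
      have hle := hbd T T' s hst₁ _ hsol s (right_mem_Icc.2 hst₁.1)
      refine ⟨locLog I G ((g s)⁻¹ * γ s), ?_,
        locExp_locLog (hall s (right_mem_Icc.2 hst₁.1)).1⟩
      rw [mem_closedBall, dist_zero_right]
      exact hle.trans ((mul_le_mul_of_nonneg_left hT' hC).trans hCη.le)
  intro t ht
  have := hKW (key ht)
  exact ⟨this.1, by simpa using (mem_ball.1 this.2).le⟩

omit [LieGroup I ∞ G] [I.Boundaryless] in
theorem cost_eq_curveCost {L φ : G → ℝ} (h01 : t₀ ≤ t₁) (hγ : IsTrajectory f t₀ t₁ g₀ T γ)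
    (huniq : ∀ γ', IsTrajectory f t₀ t₁ g₀ T γ' → EqOn γ' γ (Icc t₀ t₁)) :
    cost f t₀ t₁ g₀ L φ T = curveCost t₀ t₁ L φ γ := by
  have h : ∃ γ, IsTrajectory f t₀ t₁ g₀ T γ := ⟨γ, hγ⟩
  have he := huniq _ h.choose_spec
  rw [cost, dif_pos h, curveCost, curveCost, he (right_mem_Icc.2 h01)]
  congr 1
  refine intervalIntegral.integral_congr fun s hs => ?_
  rw [uIcc_of_le h01] at hs
  simp only [he hs]

theorem eventually_existsUnique [CompleteSpace E] [ProperSpace E] [T2Space G]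
    (hf : ∀ k, ContMDiffOn (I.prod 𝓘(ℝ, ℝ)) 𝓘(ℝ, E) 1 (M' := E)
      (fun p : G × ℝ => (f k p.1 p.2 : E)) (univ ×ˢ Icc t₀ t₁))
    (h01 : t₀ ≤ t₁) {DP DQ : Fin (n + 1) → ℝ → E →L[ℝ] E}
    (hsys : IsTubeSystem t₀ t₁ r (leftMode f g) (rightMode f g) DP DQ)
    (hr : closedBall 0 r ⊆ locTarget I G) (hg : IsTrajectory f t₀ t₁ g₀ T g) :
    ∀ᶠ T' in 𝓝 T, ∃ x : ℝ → E,
      IsTubeSolution t₀ t₁ r (leftMode f g) (rightMode f g) T T' t₁ x ∧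
      IsTrajectory f t₀ t₁ g₀ T' (fun t => g t * locExp I G (x t)) ∧
      ∀ γ', IsTrajectory f t₀ t₁ g₀ T' γ' →
        EqOn γ' (fun t => g t * locExp I G (x t)) (Icc t₀ t₁) := by
  obtain ⟨η, hη, hex⟩ := hsys.exists_isTubeSolution h01
  obtain ⟨η', hη', hmem⟩ := forall_mem_tube h01 hsys hr hg
  filter_upwards [closedBall_mem_nhds T hη, closedBall_mem_nhds T hη'] with T' hT hT'
  rw [mem_closedBall, dist_eq_norm] at hT hT'
  obtain ⟨x, hx⟩ := hex T T' hT
  refine ⟨x, hx, isTrajectory_of_isTubeSolution hf h01 hsys hr hg hx, fun γ' hγ' t ht => ?_⟩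
  have hm := hmem T' hT' γ' hγ'
  have hy := isTubeSolution_of_isTrajectory hsys hg hγ' (right_mem_Icc.2 h01)
    (fun s hs => (hm s hs).1) fun s hs => (hm s hs).2
  have := hsys.eqOn_of_isTubeSolution hx hy ht
  simp only at this ⊢
  rw [this, locExp_locLog (hm t ht).1, mul_inv_cancel_left]

end Trajectories

theorem continuousLinearMap_eq_sum_finBasis {E : Type*} [NormedAddCommGroup E] [NormedSpace ℝ E]
    [FiniteDimensional ℝ E] (p : E →L[ℝ] ℝ) :
    p = ∑ i, p (Module.finBasis ℝ E i) •
      LinearMap.toContinuousLinearMap ((Module.finBasis ℝ E).coord i) := by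
  ext v
  conv_lhs => rw [← (Module.finBasis ℝ E).sum_repr v, map_sum]
  simp [mul_comm]

theorem hasDerivAt_of_forall_apply {E : Type*} [NormedAddCommGroup E] [NormedSpace ℝ E]
    [FiniteDimensional ℝ E] {p : ℝ → E →L[ℝ] ℝ} {p' : E →L[ℝ] ℝ} {s : ℝ}
    (h : ∀ v, HasDerivAt (fun r => p r v) (p' v) s) : HasDerivAt p p' s := by
  rw [continuousLinearMap_eq_sum_finBasis p',
    funext fun r => continuousLinearMap_eq_sum_finBasis (p r)]
  refine HasDerivAt.fun_sum fun i _ => ?_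
  have hi := (h (Module.finBasis ℝ E i)).smul_const
    (LinearMap.toContinuousLinearMap ((Module.finBasis ℝ E).coord i))
  exact hi

section Main

variable {E : Type*} [NormedAddCommGroup E] [NormedSpace ℝ E] [FiniteDimensional ℝ E]
  {H : Type*} [TopologicalSpace H] {I : ModelWithCorners ℝ E H} [I.Boundaryless]
  {G : Type*} [TopologicalSpace G] [ChartedSpace H G] [Group G] [LieGroup I ∞ G]
  {n : ℕ} {t₀ t₁ r : ℝ} {g₀ : G} {f : Fin (n + 1) → G → ℝ → GroupLieAlgebra I G}
  {L φ : G → ℝ} {T : Fin n → ℝ} {g : ℝ → G}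

/-- The derivative at `x = 0` of `leftMode`. -/
def leftModeDeriv (f : Fin (n + 1) → G → ℝ → GroupLieAlgebra I G) (g : ℝ → G) (k : Fin (n + 1))
    (t : ℝ) : E →L[ℝ] E := fderiv ℝ (leftMode f g k t) 0

/-- The derivative at `x = 0` of `rightMode`. -/
def rightModeDeriv (f : Fin (n + 1) → G → ℝ → GroupLieAlgebra I G) (g : ℝ → G) (k : Fin (n + 1))
    (t : ℝ) : E →L[ℝ] E := fderiv ℝ (rightMode f g k t) 0

/-- The left-trivialized derivative as a continuous linear map on `E`. -/
def leftDerivCoord (I : ModelWithCorners ℝ E H) (F : G → ℝ) (a : G) : E →L[ℝ] ℝ :=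
  coordDeriv I F a ∘L leftTrans I a 1

omit [FiniteDimensional ℝ E] [I.Boundaryless] in
theorem contMDiffOn_mul_locExp : ContMDiffOn ((I.prod 𝓘(ℝ, ℝ)).prod 𝓘(ℝ, E)) (I.prod 𝓘(ℝ, ℝ)) ∞
    (fun p : (G × ℝ) × E => (p.1.1 * locExp I G p.2, p.1.2))
    ((univ ×ˢ Icc t₀ t₁) ×ˢ locTarget I G) := by
  have h1 : ContMDiffOn ((I.prod 𝓘(ℝ, ℝ)).prod 𝓘(ℝ, E)) I ∞
      (fun p : (G × ℝ) × E => locExp I G p.2) ((univ ×ˢ Icc t₀ t₁) ×ˢ locTarget I G) :=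
    contMDiffOn_locExp.comp contMDiff_snd.contMDiffOn fun p hp => hp.2
  exact (((contMDiff_fst.comp contMDiff_fst).contMDiffOn).mul h1).prodMk
    (contMDiff_snd.comp contMDiff_fst).contMDiffOn

theorem exists_isTubeSystem
    (hf : ∀ k, ContMDiffOn (I.prod 𝓘(ℝ, ℝ)) 𝓘(ℝ, E) 1 (M' := E)
      (fun p : G × ℝ => (f k p.1 p.2 : E)) (univ ×ˢ Icc t₀ t₁))
    (hL : ContMDiff I 𝓘(ℝ, ℝ) 1 L) (hg : ContinuousOn g (Icc t₀ t₁)) :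
    ∃ r, closedBall 0 r ⊆ locTarget I G ∧
      IsTubeSystem t₀ t₁ r (leftMode f g) (rightMode f g) (leftModeDeriv f g)
        (rightModeDeriv f g) ∧
      UniformC1 t₀ t₁ r (fun t x => L (g t * locExp I G x)) (fun t => leftDerivCoord I L (g t)) := by
  have : IsManifold I 1 G := .of_le (n := ∞) (by simp)
  obtain ⟨R, hR, hRU⟩ := Metric.isOpen_iff.1 (isOpen_locTarget I G) 0 (zero_mem_locTarget I G)
  have hUo := isOpen_locTarget I G
  have hc : ContinuousOn (fun t => (g t, t)) (Icc t₀ t₁) := hg.prodMk continuousOn_id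
  have hcS : MapsTo (fun t => (g t, t)) (Icc t₀ t₁) (univ ×ˢ Icc t₀ t₁) :=
    fun t ht => ⟨mem_univ _, ht⟩
  have hsnd : MapsTo (Prod.snd : (G × ℝ) × E → E) ((univ ×ˢ Icc t₀ t₁) ×ˢ locTarget I G)
      (locTarget I G) := fun p hp => hp.2
  have hP : ∀ k, ContMDiffOn ((I.prod 𝓘(ℝ, ℝ)).prod 𝓘(ℝ, E)) 𝓘(ℝ, E) 1
      (fun p : (G × ℝ) × E => leftFrame I G p.2 (modeCoord f k (p.1.1 * locExp I G p.2) p.1.2))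
      ((univ ×ˢ Icc t₀ t₁) ×ˢ locTarget I G) := fun k =>
    ((contDiffOn_leftFrame.contMDiffOn.of_le (by simp)).comp contMDiff_snd.contMDiffOn
      hsnd).clm_apply ((hf k).comp (contMDiffOn_mul_locExp.of_le (by simp))
        fun p hp => ⟨mem_univ _, hp.1.2⟩)
  have hQ : ∀ k, ContMDiffOn ((I.prod 𝓘(ℝ, ℝ)).prod 𝓘(ℝ, E)) 𝓘(ℝ, E) 1
      (fun p : (G × ℝ) × E => rightFrame I G p.2 (modeCoord f k p.1.1 p.1.2))
      ((univ ×ˢ Icc t₀ t₁) ×ˢ locTarget I G) := fun k =>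
    ((contDiffOn_rightFrame.contMDiffOn.of_le (by simp)).comp contMDiff_snd.contMDiffOn
      hsnd).clm_apply ((hf k).comp contMDiff_fst.contMDiffOn fun p hp => hp.1)
  have hℓ : ContMDiffOn (I.prod 𝓘(ℝ, E)) 𝓘(ℝ, ℝ) 1
      (fun p : G × E => L (p.1 * locExp I G p.2)) (univ ×ˢ locTarget I G) := by
    have h1 : ContMDiffOn (I.prod 𝓘(ℝ, E)) I 1 (fun p : G × E => locExp I G p.2)
        (univ ×ˢ locTarget I G) :=
      (contMDiffOn_locExp.of_le (by simp)).comp contMDiff_snd.contMDiffOn fun p hp => hp.2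
    have h2 : ContMDiffOn (I.prod 𝓘(ℝ, E)) I 1 (fun p : G × E => p.1 * locExp I G p.2)
        (univ ×ˢ locTarget I G) := by
      have : LieGroup I 1 G := .of_le (n := ∞) (by simp)
      exact contMDiff_fst.contMDiffOn.mul h1
    exact hL.comp_contMDiffOn h2
  refine ⟨R / 2, (closedBall_subset_ball (half_lt_self hR)).trans hRU,
    ⟨half_pos hR, fun k => ?_, fun k => ?_, fun k t _ => ?_⟩, ?_⟩
  · exact UniformC1.of_contMDiffOn (Φ := fun (p : G × ℝ) x =>
      leftFrame I G x (modeCoord f k (p.1 * locExp I G x) p.2)) hUo (hP k) (half_pos hR)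
      (half_lt_self hR) hRU hc hcS
  · exact UniformC1.of_contMDiffOn (Φ := fun (p : G × ℝ) x =>
      rightFrame I G x (modeCoord f k p.1 p.2)) hUo (hQ k) (half_pos hR)
      (half_lt_self hR) hRU hc hcS
  · rw [leftMode, rightMode, leftFrame_zero, rightFrame_zero, locExp_zero, mul_one]
  · have h := UniformC1.of_contMDiffOn (Φ := fun (a : G) x => L (a * locExp I G x)) hUo hℓ
      (half_pos hR) (half_lt_self hR) hRU hg (mapsTo_univ _ _)
    have e : ∀ t, fderiv ℝ (fun x => L (g t * locExp I G x)) 0 = leftDerivCoord I L (g t) :=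
      fun t => (hasFDerivAt_comp_mul_locExp (hL.mdifferentiableAt (by simp))).fderiv
    simpa only [e] using h

omit [FiniteDimensional ℝ E] [LieGroup I ∞ G] [I.Boundaryless] in
theorem contMDiff_modeCoord
    (hf : ∀ k, ContMDiffOn (I.prod 𝓘(ℝ, ℝ)) 𝓘(ℝ, E) 1 (M' := E)
      (fun p : G × ℝ => (f k p.1 p.2 : E)) (univ ×ˢ Icc t₀ t₁)) (k : Fin (n + 1)) {t : ℝ}
    (ht : t ∈ Icc t₀ t₁) : ContMDiff I 𝓘(ℝ, E) 1 (fun a => modeCoord f k a t) := by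
  rw [← contMDiffOn_univ]
  exact (hf k).comp (f := fun a : G => (a, t)) (contMDiff_id.prodMk contMDiff_const).contMDiffOn
    fun a _ => ⟨mem_univ _, ht⟩

omit [FiniteDimensional ℝ E] in
/-- The linearization of the tube system is the operator of the adjoint equation. -/
theorem tubeLinearization_apply
    (hf : ∀ k, ContMDiffOn (I.prod 𝓘(ℝ, ℝ)) 𝓘(ℝ, E) 1 (M' := E)
      (fun p : G × ℝ => (f k p.1 p.2 : E)) (univ ×ˢ Icc t₀ t₁))
    {t : ℝ} (ht : t ∈ Icc t₀ t₁) (η : GroupLieAlgebra I G) :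
    tubeLinearization t₀ t₁ (leftModeDeriv f g) (rightModeDeriv f g) T t (η : E)
      = (leftDerivLie (fun a => switchedField f t₀ t₁ T a t) (g t) η
        - ⁅switchedField f t₀ t₁ T (g t) t, η⁆ : GroupLieAlgebra I G) := by
  have hF : ContMDiff I 𝓘(ℝ, E) 1 (fun a => switchedCoord f t₀ t₁ T a t) :=
    contMDiff_finsetSum fun k _ => (contMDiff_const (c := modeWeight t₀ t₁ T k t)
      (I' := 𝓘(ℝ, ℝ))).smul (contMDiff_modeCoord hf k ht)
  have hkey := fderiv_leftFrame_sub_rightFrame (F := fun a => switchedField f t₀ t₁ T a t)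
    (a := g t) (hF.mdifferentiableAt (by simp)) η
  refine Eq.trans ?_ hkey
  have hmdl : ∀ k, DifferentiableAt ℝ (leftMode f g k t) 0 := fun k => by
    have hA : DifferentiableAt ℝ (leftFrame I G) 0 :=
      (contDiffOn_leftFrame.contDiffAt ((isOpen_locTarget I G).mem_nhds
        (zero_mem_locTarget I G))).differentiableAt (by simp)
    exact hA.clm_apply (hasFDerivAt_comp_mul_locExp ((contMDiff_modeCoord hf k
      ht).mdifferentiableAt (by simp))).differentiableAt
  have hmdr : ∀ k, DifferentiableAt ℝ (rightMode f g k t) 0 := fun k => by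
    have hB : DifferentiableAt ℝ (rightFrame I G) 0 :=
      (contDiffOn_rightFrame.contDiffAt ((isOpen_locTarget I G).mem_nhds
        (zero_mem_locTarget I G))).differentiableAt (by simp)
    exact hB.clm_apply (differentiableAt_const _)
  have e1 : fderiv ℝ (fun x => leftFrame I G x (switchedCoord f t₀ t₁ T (g t * locExp I G x) t)) 0
      = ∑ k, modeWeight t₀ t₁ T k t • leftModeDeriv f g k t := by
    have h := HasFDerivAt.fun_sum (u := Finset.univ) fun k _ =>
      ((hmdl k).hasFDerivAt.const_smul (modeWeight t₀ t₁ T k t))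
    refine Eq.trans ?_ (HasFDerivAt.fderiv h)
    congr 1
    ext x
    simp only [switchedCoord, map_sum, map_smul, leftMode, Pi.smul_apply]
  have e2 : fderiv ℝ (fun x => rightFrame I G x (switchedCoord f t₀ t₁ T (g t) t)) 0
      = ∑ k, modeWeight t₀ t₁ T k t • rightModeDeriv f g k t := by
    have h := HasFDerivAt.fun_sum (u := Finset.univ) fun k _ =>
      ((hmdr k).hasFDerivAt.const_smul (modeWeight t₀ t₁ T k t))
    refine Eq.trans ?_ (HasFDerivAt.fderiv h)
    congr 1
    ext x
    simp only [switchedCoord, map_sum, map_smul, rightMode, Pi.smul_apply]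
  have e3 : tubeLinearization t₀ t₁ (leftModeDeriv f g) (rightModeDeriv f g) T t
      = fderiv ℝ (fun x => leftFrame I G x (switchedCoord f t₀ t₁ T (g t * locExp I G x) t)) 0
        - fderiv ℝ (fun x => rightFrame I G x (switchedCoord f t₀ t₁ T (g t) t)) 0 := by
    rw [e1, e2, tubeLinearization, ← Finset.sum_sub_distrib]
    simp only [smul_sub]
  exact DFunLike.congr_fun e3 (η : E)

/-- A costate, as a curve of continuous linear forms. -/
theorem IsCostate.exists_coord
    (hf : ∀ k, ContMDiffOn (I.prod 𝓘(ℝ, ℝ)) 𝓘(ℝ, E) 1 (M' := E)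
      (fun p : G × ℝ => (f k p.1 p.2 : E)) (univ ×ˢ Icc t₀ t₁))
    {ρ : ℝ → Module.Dual ℝ (GroupLieAlgebra I G)} (hρ : IsCostate f t₀ t₁ L φ T g ρ) :
    ∃ p : ℝ → E →L[ℝ] ℝ, (∀ s (v : GroupLieAlgebra I G), p s (v : E) = ρ s v) ∧
      ContinuousOn p (Icc t₀ t₁) ∧ p t₁ = leftDerivCoord I φ (g t₁) ∧
      ∀ s ∈ Ioo t₀ t₁, s ∉ range (times t₀ t₁ T) →
      HasDerivAt p (-(p s ∘L tubeLinearization t₀ t₁ (leftModeDeriv f g) (rightModeDeriv f g) T s)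
        - leftDerivCoord I L (g s)) s := by
  let p : ℝ → E →L[ℝ] ℝ := fun s =>
    LinearMap.toContinuousLinearMap (show E →ₗ[ℝ] ℝ from ρ s)
  have hp : ∀ s (v : GroupLieAlgebra I G), p s (v : E) = ρ s v := fun s v => rfl
  refine ⟨p, hp, ?_, ?_, fun s hs hsT => ?_⟩
  · rw [continuousOn_clm_apply]
    exact hρ.continuousOn
  · ext v
    exact hρ.terminal v
  · have hs' := Ioo_subset_Icc_self hs
    refine hasDerivAt_of_forall_apply fun v => ?_
    have h := hρ.ode s hs' hsT v
    have e := tubeLinearization_apply (g := g) (T := T) hf hs' (v : GroupLieAlgebra I G)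
    have e' : (-(p s ∘L tubeLinearization t₀ t₁ (leftModeDeriv f g) (rightModeDeriv f g) T s)
        - leftDerivCoord I L (g s)) v
        = -p s (tubeLinearization t₀ t₁ (leftModeDeriv f g) (rightModeDeriv f g) T s v)
          - leftDerivCoord I L (g s) v := by simp
    rw [e', e]
    exact h

theorem exists_isCostate
    (hf : ∀ k, ContMDiffOn (I.prod 𝓘(ℝ, ℝ)) 𝓘(ℝ, E) 1 (M' := E)
      (fun p : G × ℝ => (f k p.1 p.2 : E)) (univ ×ˢ Icc t₀ t₁)) (h01 : t₀ ≤ t₁)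
    (hsys : IsTubeSystem t₀ t₁ r (leftMode f g) (rightMode f g) (leftModeDeriv f g)
        (rightModeDeriv f g))
    (hℓ : UniformC1 t₀ t₁ r (fun t x => L (g t * locExp I G x))
      (fun t => leftDerivCoord I L (g t))) :
    ∃ ρ : ℝ → Module.Dual ℝ (GroupLieAlgebra I G), IsCostate f t₀ t₁ L φ T g ρ := by
  obtain ⟨p, hpc, hp1, hp⟩ := exists_costate h01
    (fun k => (hsys.left k).continuousOn_deriv.sub (hsys.right k).continuousOn_deriv)
    hℓ.continuousOn_deriv T (leftDerivCoord I φ (g t₁))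
  refine ⟨fun s => (p s : E →ₗ[ℝ] ℝ), ⟨fun η => ?_, fun η => ?_, fun s hs hsT η => ?_⟩⟩
  · exact DFunLike.congr_fun hp1 (η : E)
  · have h : ∀ v : E, ContinuousOn (fun s => p s v) (Icc t₀ t₁) := fun v =>
      hpc.clm_apply continuousOn_const
    exact h η
  · have h : ∀ v : E, HasDerivAt (fun r => p r v)
        ((-(p s ∘L tubeLinearization t₀ t₁ (leftModeDeriv f g) (rightModeDeriv f g) T s)
          - leftDerivCoord I L (g s)) v) s := fun v => by
      have h := (hp s (mem_Ioo_of_notMem_range_times hs hsT) hsT).clm_apply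
        (hasDerivAt_const s v)
      rw [map_zero, add_zero] at h
      exact h
    have hd := h η
    have e := tubeLinearization_apply (g := g) (T := T) hf hs η
    have e' : (-(p s ∘L tubeLinearization t₀ t₁ (leftModeDeriv f g) (rightModeDeriv f g) T s)
        - leftDerivCoord I L (g s)) (η : E)
        = -p s (tubeLinearization t₀ t₁ (leftModeDeriv f g) (rightModeDeriv f g) T s (η : E))
          - leftDerivCoord I L (g s) (η : E) := rfl
    rw [e] at e'
    exact e' ▸ hd

end Main

end LieSwitched
end

theorem lemma1
    {E : Type*} [NormedAddCommGroup E] [NormedSpace ℝ E] [FiniteDimensional ℝ E]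
    {H : Type*} [TopologicalSpace H] (I : ModelWithCorners ℝ E H) [I.Boundaryless]
    {G : Type*} [TopologicalSpace G] [ChartedSpace H G] [Group G] [LieGroup I ∞ G] [T2Space G]
    (n : ℕ) (t₀ t₁ : ℝ) (g₀ : G)
    (f : Fin (n + 1) → G → ℝ → GroupLieAlgebra I G)
    (hf : ∀ k, ContMDiffOn (I.prod 𝓘(ℝ, ℝ)) 𝓘(ℝ, E) 1 (M' := E)
      (fun p : G × ℝ => (f k p.1 p.2 : E)) (Set.univ ×ˢ Set.Icc t₀ t₁))
    (L φ : G → ℝ) (hL : ContMDiff I 𝓘(ℝ, ℝ) 1 L) (hφ : MDifferentiable I 𝓘(ℝ, ℝ) φ)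
    (T : Fin n → ℝ) (hT : T ∈ LieSwitched.admissible n t₀ t₁)
    (g : ℝ → G) (hg : LieSwitched.IsTrajectory f t₀ t₁ g₀ T g) :
    -- near `T`, trajectories exist and are unique, so that the objective is well defined
    (∀ᶠ T' in 𝓝[LieSwitched.admissible n t₀ t₁] T,
      ∃ γ : ℝ → G, LieSwitched.IsTrajectory f t₀ t₁ g₀ T' γ ∧
        ∀ γ' : ℝ → G, LieSwitched.IsTrajectory f t₀ t₁ g₀ T' γ' →
          Set.EqOn γ' γ (Set.Icc t₀ t₁)) ∧
    -- the costate exists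
    (∃ ρ : ℝ → Module.Dual ℝ (GroupLieAlgebra I G),
      LieSwitched.IsCostate f t₀ t₁ L φ T g ρ) ∧
    ∀ ρ : ℝ → Module.Dual ℝ (GroupLieAlgebra I G),
      LieSwitched.IsCostate f t₀ t₁ L φ T g ρ →
      -- the gradient of the objective on the set of admissible transition times
      HasFDerivWithinAt (LieSwitched.cost f t₀ t₁ g₀ L φ)
        (∑ i : Fin n, (ρ (T i) (f i.castSucc (g (T i)) (T i) - f i.succ (g (T i)) (T i))) •
          (ContinuousLinearMap.proj i : (Fin n → ℝ) →L[ℝ] ℝ))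
        (LieSwitched.admissible n t₀ t₁) T ∧
      -- its components, the derivatives with respect to the single transition times
      ∀ i : Fin n,
        HasDerivWithinAt (fun s => LieSwitched.cost f t₀ t₁ g₀ L φ (Function.update T i s))
          (ρ (T i) (f i.castSucc (g (T i)) (T i) - f i.succ (g (T i)) (T i)))
          {s | Function.update T i s ∈ LieSwitched.admissible n t₀ t₁} (T i) := by
  have h01 := LieSwitched.le_of_admissible hT
  have : CompleteSpace E := FiniteDimensional.complete ℝ E
  have : ProperSpace E := FiniteDimensional.proper ℝ E
  obtain ⟨r, hr, hsys, hℓ⟩ := LieSwitched.exists_isTubeSystem hf hL hg.continuousOn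
  have hev := LieSwitched.eventually_existsUnique hf h01 hsys hr hg
  refine ⟨?_, LieSwitched.exists_isCostate hf h01 hsys hℓ, fun ρ hρ => ?_⟩
  · filter_upwards [mem_nhdsWithin_of_mem_nhds hev] with T' ⟨x, _, hx, hu⟩
    exact ⟨_, hx, hu⟩
  obtain ⟨p, hpρ, hpc, hp1, hp⟩ := hρ.exists_coord hf
  have hψ : HasFDerivAt (fun x => φ (g t₁ * LieSwitched.locExp I G x)) (p t₁) 0 := by
    rw [hp1]
    exact LieSwitched.hasFDerivAt_comp_mul_locExp (hφ (g t₁))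
  have hd := hsys.hasFDerivWithinAt_cost hT hℓ hψ hpc hp (J := LieSwitched.cost f t₀ t₁ g₀ L φ) (by
    filter_upwards [mem_nhdsWithin_of_mem_nhds hev] with T' ⟨x, hx, hxt, hu⟩
    exact ⟨x, hx, LieSwitched.cost_eq_curveCost h01 hxt hu⟩)
  have hcoef : ∀ i : Fin n, p (T i) (LieSwitched.leftMode f g i.castSucc (T i) 0)
      - p (T i) (LieSwitched.leftMode f g i.succ (T i) 0)
      = ρ (T i) (f i.castSucc (g (T i)) (T i) - f i.succ (g (T i)) (T i)) := fun i => by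
    rw [map_sub, LieSwitched.leftMode, LieSwitched.leftMode, LieSwitched.leftFrame_zero,
      LieSwitched.leftFrame_zero, LieSwitched.locExp_zero, mul_one]
    exact congrArg₂ (· - ·) (hpρ _ _) (hpρ _ _)
  simp only [hcoef] at hd
  refine ⟨hd, fun i => ?_⟩
  have hu : HasDerivWithinAt (fun s => Function.update T i s) (Pi.single i 1)
      {s | Function.update T i s ∈ LieSwitched.admissible n t₀ t₁} (T i) :=
    (hasDerivAt_update T i (T i)).hasDerivWithinAt
  have hc := HasFDerivWithinAt.comp_hasDerivWithinAt (T i) (Function.update_eq_self i T ▸ hd) hu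
    fun s hs => hs
  convert! hc using 1
  simp [Pi.single_apply]
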